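/- **Setting.** Let $n\ge 2$, $0<\kappa<1$, $0<c_1<c_2$. Let $\Omega\subset S^{n-1}$ be a domain (relatively open and connected), $\Sigma\subset\mathbb R^n$ a Borel set (the target), $\Gamma=\{rx: x\in\Omega,\ c_1\le r\le c_2\}$, and let $H^{n-1}$ be the $(n-1)$-dimensional Hausdorff measure. For $X\in\Gamma$ write $x=X/|X|$. *Ovals.* For $x\in S^{n-1}$ put $$\rho(x,Y,b)=\frac{b-\kappa^2 x\cdot Y-\sqrt{(b-\kappa^2x\cdot Y)^2-(1-\kappa^2)(b^2-\kappa^2|Y|^2)}}{1-\kappa^2},\qquad h(x,Y,X_0)=\rho\big(x,Y,|X_0|+\kappa|X_0-Y|\big).$$ *Curves.* For $x_0,\bar m,\hat m\in S^{n-1}$ with $\bar m\cdot x_0\ge\kappa$, $\hat m\cdot x_0\ge\kappa$ and $\lambda\in[0,1]$ let $\xi=(1-\lambda)\bar m+\lambda\hat m-\frac1\kappa x_0$, $$\beta(\lambda)=\frac{-x_0\cdot\xi-\sqrt{(x_0\cdot\xi)^2-(1-\kappa^2)|\xi|^2}}{\kappa|\xi|^2},\qquad m(\lambda)=\tfrac1\kappa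 x_0+\beta(\lambda)\,\xi,$$ and $[\bar m,\hat m]_{x_0}=\{m(\lambda):0\le\lambda\le1\}\subset S^{n-1}$. *Structural hypotheses.* * **H.A** (a) $x\cdot\frac{Y-X}{|Y-X|}\ge\kappa$ for all $X\in\Gamma$, $Y\in\Sigma$. (b) For each $X\in\Gamma$ there are a set $E(X)\subset\{m\in S^{n-1}:m\cdot x\ge\kappa\}$ and a continuous $s_X:E(X)\to(0,\infty)$ with $\Sigma=\{X+s_X(m)m:m\in E(X)\}$, and $[\bar m,\hat m]_x\subset E(X)$ for all $\bar m,\hat m\in E(X)$. (c) There is $C>0$ with $|s_X(m_1)-s_X(m_2)|\le C|m_1-m_2|$ for all $X\in\Gamma$, $m_1,m_2\in E(X)$. * **H.B** $\frac{|X|}{|Y-X|}\le\kappa\big(\sqrt{1+(1+\kappa)^{-2}}-1\big)$ for all $X\in\Gamma$, $Y\in\Sigma$. * **H.C** There is $0\le\mu_1<\kappa$ such that for all $X_0\in\Gamma$, $\bar m,\hat m\in E(X_0)$, $\lambda\in[0,1]$, with $\beta(\lambda)$, $m(\lambda)$ taken for $x_0=X_0/|X_0|$, $$\frac1{s_{X_0}(m(\lambda))}+\frac{\mu_1}{|X_0|}\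 \ge\ (1-\lambda)\beta(\lambda)\Big(\frac1{s_{X_0}(\bar m)}+\frac{\mu_1}{|X_0|}\Big)+\lambda\beta(\lambda)\Big(\frac1{s_{X_0}(\hat m)}+\frac{\mu_1}{|X_0|}\Big).$$ * **H.D** There are $t_0,C>0$ such that for all $X_0\in\Gamma$, $\bar Y,\hat Y\in\Sigma$ and $0<t\le t_0$ $$H^{n-1}\Big(N_t\big(\{Y(\lambda):\tfrac14\le\lambda\le\tfrac34\}\big)\cap\Sigma\Big)\ge C\,t^{\,n-2}\,|\bar Y-\hat Y|,$$ where $N_t$ is the $t$-neighborhood in $\mathbb R^n$, $Y(\lambda)=X_0+s_{X_0}(m(\lambda))\,m(\lambda)$, and $m(\lambda)$ is taken for $x_0=\frac{X_0}{|X_0|}$, $\bar m=\frac{\bar Y-X_0}{|\bar Y-X_0|}$, $\hat m=\frac{\hat Y-X_0}{|\hat Y-X_0|}$. *Weak solutions.* A function $u:\Omega\to[c_1,c_2]$ is a refractor from $\Omega$ to $\Sigma$ if for each $x_0\in\Omega$ the set $$\partial u(x_0)=\{Y\in\Sigma: u(x)\ge h(x,Y,u(x_0)x_0)\ \text{for all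 }x\in\Omega\}$$ is non-empty. For $B\subset\Sigma$ let $\mathcal T_u(B)=\{x\in\Omega:\partial u(x)\cap B\ne\emptyset\}$, and for $A\subset\Omega$ let $\partial u(A)=\bigcup_{x\in A}\partial u(x)$. Let $\mu=f\,dx$, with $dx$ the surface measure on $\Omega$ and $f>0$ a.e., and let $\nu$ be a Borel measure on $\Sigma$. A weak solution is a refractor $u$ with $\mu(\mathcal T_u(B))=\nu(B)$ for all Borel $B\subset\Sigma$ (in particular $\int_\Omega f\,dx=\nu(\Sigma)$). **Theorem.** Assume H.A, H.B, H.C, H.D, and that $\Sigma$ is differentiable, i.e. it has a tangent hyperplane at each of its points $Y$: there is a unit vector $N$ with $(Z-Y)\cdot N=o(|Z-Y|)$ as $Z\to Y$, $Z\in\Sigma$. Assume $f\in L^\infty(\Omega)$, $\nu\ll H^{n-1}$, and that on $\Sigma$ one has $dH^{n-1}=g\,d\nu$ with $g$ measurable and $0\le g\le\alpha$ a.e. for a constant $\alpha$. Then every weak solution $u$ satisfies the following. 1. There is a constant $C$ such that $H^{n-1}\big(\partial u(B_\sigma\cap S^{n-1})\big)\le C\sigma^{n-1}$ for every ball $B_\sigma\subset\mathbb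 R^n$ of radius $\sigma$ with $B_\sigma\cap S^{n-1}\subset\Omega$. 2. $u\in C^{1,\gamma}_{\rm loc}(\Omega)$ with $\gamma=\frac1{4n-5}$: the function $\tilde u(X)=u(X/|X|)$ is differentiable at every point of $\Omega$, and for every compact $K\subset\Omega$ there is $C_K$ with $|\nabla\tilde u(x)-\nabla\tilde u(y)|\le C_K|x-y|^{\gamma}$ for all $x,y\in K$. -/

import Mathlib

open MeasureTheory Set
open scoped ENNReal

noncomputable section

namespace NearField

/-- Euclidean space of dimension `n`. -/
abbrev Rn (n : ℕ) := EuclideanSpace ℝ (Fin n)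

/-- The unit sphere of `ℝⁿ`. -/
def unitSphere (n : ℕ) : Set (Rn n) := Metric.sphere 0 1

/-- The `(n-1)`-dimensional Hausdorff measure on `ℝⁿ`. Its restriction to the unit sphere is, up to
a constant factor that depends only on `n`, the surface measure `dx`. -/
def hausdorff (n : ℕ) : Measure (Rn n) := μH[(n : ℝ) - 1]

variable {n : ℕ}

/-- The polar radius `ρ(x, Y, b)` of the Descartes oval `{X : |X| + κ |X - Y| = b}`. -/
def ovalRadius (κ : ℝ) (x Y : Rn n) (b : ℝ) : ℝ :=
  (b - κ ^ 2 * inner ℝ x Y -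
    √((b - κ ^ 2 * inner ℝ x Y) ^ 2 - (1 - κ ^ 2) * (b ^ 2 - κ ^ 2 * ‖Y‖ ^ 2))) / (1 - κ ^ 2)

/-- `h(x, Y, X₀)`: the polar radius of the oval with focus `Y` that passes through `X₀`. -/
def ovalThrough (κ : ℝ) (x Y X₀ : Rn n) : ℝ :=
  ovalRadius κ x Y (‖X₀‖ + κ * ‖X₀ - Y‖)

/-- `Γ = {r x : x ∈ Ω, c₁ ≤ r ≤ c₂}`. -/
def Gam (Ω : Set (Rn n)) (c₁ c₂ : ℝ) : Set (Rn n) :=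
  {X | ∃ x ∈ Ω, ∃ r : ℝ, c₁ ≤ r ∧ r ≤ c₂ ∧ X = r • x}

/-- The unit vector in the direction of `v`. -/
def dir (v : Rn n) : Rn n := ‖v‖⁻¹ • v

/-- The vector `ξ = m_l - x₀/κ`, with `m_l = (1-l) m₁ + l m₂`. -/
def chordVec (κ : ℝ) (x₀ m₁ m₂ : Rn n) (l : ℝ) : Rn n :=
  ((1 - l) • m₁ + l • m₂) - κ⁻¹ • x₀

/-- The coefficient `β(l)`: the smaller root of `|x₀/κ + β ξ| = 1`. -/
def betaCoef (κ : ℝ) (x₀ m₁ m₂ : Rn n) (l : ℝ) : ℝ :=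
  (-(inner ℝ x₀ (chordVec κ x₀ m₁ m₂ l)) -
      √((inner ℝ x₀ (chordVec κ x₀ m₁ m₂ l)) ^ 2 -
        (1 - κ ^ 2) * ‖chordVec κ x₀ m₁ m₂ l‖ ^ 2)) /
    (κ * ‖chordVec κ x₀ m₁ m₂ l‖ ^ 2)

/-- The parametrization `m(l)`, `0 ≤ l ≤ 1`, of the curve `[m₁, m₂]_{x₀}` in which the sphere meets
the triangle with vertices `m₁`, `m₂`, `x₀/κ`. -/
def curvePt (κ : ℝ) (x₀ m₁ m₂ : Rn n) (l : ℝ) : Rn n :=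
  κ⁻¹ • x₀ + betaCoef κ x₀ m₁ m₂ l • chordVec κ x₀ m₁ m₂ l

/-- The point `Y(l) = X₀ + s_{X₀}(m(l)) m(l)` of the curve `[Y₁, Y₂]_{X₀}` in the target. -/
def targetCurvePt (κ : ℝ) (s : Rn n → Rn n → ℝ) (X₀ Y₁ Y₂ : Rn n) (l : ℝ) : Rn n :=
  X₀ + s X₀ (curvePt κ (dir X₀) (dir (Y₁ - X₀)) (dir (Y₂ - X₀)) l) •
    curvePt κ (dir X₀) (dir (Y₁ - X₀)) (dir (Y₂ - X₀)) l

/-- Hypothesis H.A on the target `S`: every point of `S` can be reached by refraction from every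
point of `Γ`, and, seen from `X ∈ Γ`, the target is the graph of `s X` over the set `E X` of
directions; `E X` is convex with respect to the curves `[m₁, m₂]_x`, and the functions `s X` are
uniformly Lipschitz. -/
structure HypA (κ c₁ c₂ : ℝ) (Ω S : Set (Rn n)) (E : Rn n → Set (Rn n))
    (s : Rn n → Rn n → ℝ) : Prop where
  refracts : ∀ X ∈ Gam Ω c₁ c₂, ∀ Y ∈ S, κ ≤ inner ℝ (dir X) (dir (Y - X))
  directions : ∀ X ∈ Gam Ω c₁ c₂, E X ⊆ {m | m ∈ unitSphere n ∧ κ ≤ inner ℝ m (dir X)}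
  pos : ∀ X ∈ Gam Ω c₁ c₂, ∀ m ∈ E X, 0 < s X m
  cont : ∀ X ∈ Gam Ω c₁ c₂, ContinuousOn (s X) (E X)
  graph : ∀ X ∈ Gam Ω c₁ c₂, S = (fun m => X + s X m • m) '' E X
  convex : ∀ X ∈ Gam Ω c₁ c₂, ∀ m₁ ∈ E X, ∀ m₂ ∈ E X, ∀ l ∈ Icc (0 : ℝ) 1,
    curvePt κ (dir X) m₁ m₂ l ∈ E X
  lipschitz : ∃ C : ℝ, 0 < C ∧ ∀ X ∈ Gam Ω c₁ c₂, ∀ m₁ ∈ E X, ∀ m₂ ∈ E X,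
    |s X m₁ - s X m₂| ≤ C * ‖m₁ - m₂‖

/-- Hypothesis H.B: the target is far away from `Γ`. -/
def HypB (κ c₁ c₂ : ℝ) (Ω S : Set (Rn n)) : Prop :=
  ∀ X ∈ Gam Ω c₁ c₂, ∀ Y ∈ S, ‖X‖ / ‖Y - X‖ ≤ κ * (√(1 + ((1 + κ) ^ 2)⁻¹) - 1)

/-- Hypothesis H.C: the concavity condition on the functions `s X₀`. -/
def HypC (κ c₁ c₂ : ℝ) (Ω : Set (Rn n)) (E : Rn n → Set (Rn n)) (s : Rn n → Rn n → ℝ) : Prop :=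
  ∃ μ : ℝ, 0 ≤ μ ∧ μ < κ ∧
    ∀ X₀ ∈ Gam Ω c₁ c₂, ∀ m₁ ∈ E X₀, ∀ m₂ ∈ E X₀, ∀ l ∈ Icc (0 : ℝ) 1,
      (1 - l) * betaCoef κ (dir X₀) m₁ m₂ l * (1 / s X₀ m₁ + μ / ‖X₀‖) +
          l * betaCoef κ (dir X₀) m₁ m₂ l * (1 / s X₀ m₂ + μ / ‖X₀‖) ≤
        1 / s X₀ (curvePt κ (dir X₀) m₁ m₂ l) + μ / ‖X₀‖

/-- Hypothesis H.D: neighbourhoods of the middle half of each curve `[Y₁, Y₂]_{X₀}` occupy a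
sufficiently large part of the target. -/
def HypD (κ c₁ c₂ : ℝ) (Ω S : Set (Rn n)) (s : Rn n → Rn n → ℝ) : Prop :=
  ∃ μ₀ C : ℝ, 0 < μ₀ ∧ 0 < C ∧
    ∀ X₀ ∈ Gam Ω c₁ c₂, ∀ Y₁ ∈ S, ∀ Y₂ ∈ S, ∀ μ : ℝ, 0 < μ → μ ≤ μ₀ →
      ENNReal.ofReal (C * μ ^ (n - 2) * ‖Y₁ - Y₂‖) ≤
        hausdorff n
          (Metric.thickening μ (targetCurvePt κ s X₀ Y₁ Y₂ '' Icc (1 / 4 : ℝ) (3 / 4)) ∩ S)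

/-- The surface `S` is differentiable: at each of its points `Y` it has a tangent hyperplane
`Y + N^⊥`, that is, `⟨Z - Y, N⟩ = o(|Z - Y|)` as `Z → Y` in `S`. -/
def DifferentiableSurface (S : Set (Rn n)) : Prop :=
  ∀ Y ∈ S, ∃ N : Rn n, ‖N‖ = 1 ∧
    (fun Z : Rn n => inner ℝ (Z - Y) N) =o[nhdsWithin Y S] (fun Z : Rn n => Z - Y)

/-- `∂u(x₀)`: the points `Y` of the target such that the oval with focus `Y` through
`X₀ = u(x₀) x₀` supports `u` from below on `Ω`. -/
def subdiff (κ : ℝ) (Ω S : Set (Rn n)) (u : Rn n → ℝ) (x₀ : Rn n) : Set (Rn n) :=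
  {Y | Y ∈ S ∧ ∀ x ∈ Ω, ovalThrough κ x Y (u x₀ • x₀) ≤ u x}

/-- `u : Ω → [c₁, c₂]` is a refractor from `Ω` to `S`. Only the values of `u` on `Ω` matter. -/
def IsRefractor (κ c₁ c₂ : ℝ) (Ω S : Set (Rn n)) (u : Rn n → ℝ) : Prop :=
  (∀ x ∈ Ω, u x ∈ Icc c₁ c₂) ∧ ∀ x ∈ Ω, (subdiff κ Ω S u x).Nonempty

/-- The tracing map `T_u(B) = {x ∈ Ω : ∂u(x) ∩ B ≠ ∅}`. -/
def tracing (κ : ℝ) (Ω S : Set (Rn n)) (u : Rn n → ℝ) (B : Set (Rn n)) : Set (Rn n) :=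
  {x | x ∈ Ω ∧ ∃ Y ∈ B, Y ∈ subdiff κ Ω S u x}

/-- The measure `f(x) dx` on `Ω`. -/
def sourceMeasure (Ω : Set (Rn n)) (f : Rn n → ℝ) : Measure (Rn n) :=
  ((hausdorff n).restrict Ω).withDensity (fun x => ENNReal.ofReal (f x))

/-- `u` is a weak solution of the refractor problem with source density `f` and target
measure `ν`. -/
def IsWeakSolution (κ c₁ c₂ : ℝ) (Ω S : Set (Rn n)) (f : Rn n → ℝ) (ν : Measure (Rn n))
    (u : Rn n → ℝ) : Prop :=
  IsRefractor κ c₁ c₂ Ω S u ∧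
    ∀ B : Set (Rn n), MeasurableSet B → B ⊆ S →
      sourceMeasure Ω f (tracing κ Ω S u B) = ν B

/-- `H^{n-1}(∂u(B_σ ∩ S^{n-1})) ≤ C σ^{n-1}` for all balls `B_σ` with `B_σ ∩ S^{n-1} ⊆ Ω`. -/
def MeasureCondition (κ : ℝ) (Ω S : Set (Rn n)) (u : Rn n → ℝ) : Prop :=
  ∃ C : ℝ, ∀ (c : Rn n) (σ : ℝ), 0 < σ → Metric.ball c σ ∩ unitSphere n ⊆ Ω →
    hausdorff n (⋃ x ∈ Metric.ball c σ ∩ unitSphere n, subdiff κ Ω S u x) ≤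
      ENNReal.ofReal (C * σ ^ (n - 1))

/-- The extension of `u` that is homogeneous of degree zero, `X ↦ u(X/|X|)`. -/
def radialExt (u : Rn n → ℝ) (X : Rn n) : ℝ := u (dir X)

/-- `u ∈ C^{1,a}_loc(Ω)` for `Ω` open in the unit sphere: the extension `X ↦ u(X/|X|)` is
differentiable at the points of `Ω`, and its derivative (the tangential gradient of `u`) is
Hölder continuous with exponent `a` on each compact subset of `Ω`. -/
def C1HolderLoc (a : ℝ) (Ω : Set (Rn n)) (u : Rn n → ℝ) : Prop :=
  (∀ x ∈ Ω, DifferentiableAt ℝ (radialExt u) x) ∧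
    ∀ K : Set (Rn n), K ⊆ Ω → IsCompact K → ∃ C : ℝ, ∀ x ∈ K, ∀ y ∈ K,
      ‖fderiv ℝ (radialExt u) x - fderiv ℝ (radialExt u) y‖ ≤ C * ‖x - y‖ ^ a

end NearField

end

/-!
`Y` supports the refractor `u` at `x` iff the optical path `X ↦ |X| + κ |X - Y|` is minimal over
the surface `{u(x) x}` at the point over `x`. All `Y ∈ Σ` but an `H^{n-1}`-null set, which comes
from the non-differentiability of the minimal value as a function of `Y`, support `u` at one
point only. Hence `H^{n-1}(∂u(A)) ≤ α ν(∂u(A)) ≤ α ‖f‖_∞ H^{n-1}(A)`, and caps of radius `σ` have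
measure `O(σ^{n-1})`.

For the regularity let `Y₁ ∈ ∂u(x₁)` and `Y₂ ∈ ∂u(x₂)`. By H.C, the optical path to the points of
the middle half of the curve `[Y₁, Y₂]_{X₁}` grows at least like `|Y₁ - Y₂|² |x - x₁|²` as `x` moves
away from `x₁`, up to an error `O(|x₁ - x₂| |Y₁ - Y₂|)`. If `|x₁ - x₂| ≲ |Y₁ - Y₂| η²`, then every
point of `Σ` within distance `≈ |Y₁ - Y₂|² η` of this half curve supports `u` at some point within
distance `η` of `x₁`. The bound for `∂u` on caps and H.D then give `|Y₁ - Y₂|^{2n-3} ≲ η`, and the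
optimal `η` gives `|Y₁ - Y₂| ≲ |x₁ - x₂|^{1/(4n-5)}`. Finally, the tangential gradient of `u` at `x`
is a Lipschitz function of `x`, `u(x)` and the direction from `u(x) x` to any `Y ∈ ∂u(x)`.
-/

noncomputable section

namespace NearField

/-! ### Ovals and supporting points -/

section

section OpticalPath

variable {V : Type*} [NormedAddCommGroup V]

/-- The optical length `|X| + κ |X - Y|` of the broken path from the origin through `X` to `Y`.
Its level sets, as a function of `X`, are the Descartes ovals with focus `Y`. -/
def opticalPath (κ : ℝ) (X Y : V) : ℝ := ‖X‖ + κ * ‖X - Y‖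

lemma continuous_opticalPath {T : Type*} [TopologicalSpace T] {κ : ℝ} {v w : T → V}
    (hv : Continuous v) (hw : Continuous w) : Continuous fun t => opticalPath κ (v t) (w t) := by
  unfold opticalPath
  fun_prop

lemma opticalPath_sub_le {κ : ℝ} (hκ : 0 ≤ κ) (X Y Z : V) :
    opticalPath κ X Y - opticalPath κ X Z ≤ κ * ‖Y - Z‖ := by
  have h : ‖X - Y‖ ≤ ‖X - Z‖ + ‖Y - Z‖ := by
    rw [norm_sub_rev Y Z]; exact norm_sub_le_norm_sub_add_norm_sub X Z Y
  unfold opticalPath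
  nlinarith

lemma norm_smul_sub_smul_le [NormedSpace ℝ V] (a b : ℝ) (x y : V) :
    ‖a • x - b • y‖ ≤ |a - b| * ‖x‖ + |b| * ‖x - y‖ := by
  have h : a • x - b • y = (a - b) • x + b • (x - y) := by module
  rw [h, ← Real.norm_eq_abs, ← Real.norm_eq_abs, ← norm_smul, ← norm_smul]
  exact norm_add_le _ _

end OpticalPath

lemma le_sqrt_sq_sub_iff {p c : ℝ} : p ≤ √(p ^ 2 - c) ↔ p ≤ 0 ∨ c ≤ 0 := by
  rcases le_or_gt p 0 with hp | hp
  · simp only [hp, true_or, iff_true]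
    exact hp.trans (Real.sqrt_nonneg _)
  · rw [Real.le_sqrt' hp]
    simp [hp.not_ge]

variable {n : ℕ} {κ c₁ c₂ : ℝ} {Ω S : Set (Rn n)} {u : Rn n → ℝ}

lemma norm_eq_one_of_mem (hΩ : Ω ⊆ unitSphere n) {x : Rn n} (hx : x ∈ Ω) : ‖x‖ = 1 :=
  mem_sphere_zero_iff_norm.1 (hΩ hx)

lemma ovalRadius_le_iff (hκ0 : 0 < κ) (hκ1 : κ < 1) {x : Rn n} (hx : ‖x‖ = 1) (Y : Rn n)
    (b t : ℝ) : ovalRadius κ x Y b ≤ t ↔ b ≤ t + κ * ‖t • x - Y‖ := by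
  have hk : 0 < 1 - κ ^ 2 := by nlinarith
  set N := ‖t • x - Y‖ with hN_def
  set a : ℝ := inner ℝ x Y
  set p := b - κ ^ 2 * a - (1 - κ ^ 2) * t with hp
  have hN : N ^ 2 = t ^ 2 - 2 * t * a + ‖Y‖ ^ 2 := by
    rw [hN_def, norm_sub_sq_real, norm_smul, hx, real_inner_smul_left, mul_one, Real.norm_eq_abs,
      sq_abs]
    ring
  have hta : |t - a| ≤ N := by
    have h := abs_real_inner_le_norm x (t • x - Y)
    rwa [inner_sub_right, real_inner_smul_right, real_inner_self_eq_norm_sq, hx, one_mul,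
      one_pow, mul_one] at h
  have hdisc : (b - κ ^ 2 * a) ^ 2 - (1 - κ ^ 2) * (b ^ 2 - κ ^ 2 * ‖Y‖ ^ 2) =
      p ^ 2 - (1 - κ ^ 2) * ((b - t) ^ 2 - (κ * N) ^ 2) := by
    rw [mul_pow, hN]; ring
  have hN0 : 0 ≤ N := norm_nonneg _
  have hκN : κ ^ 2 * N ≤ κ * N := mul_le_mul_of_nonneg_right (by nlinarith) hN0
  have hκta : |κ ^ 2 * (t - a)| ≤ κ * N := by
    rw [abs_mul, abs_sq]
    exact (mul_le_mul_of_nonneg_left hta (sq_nonneg κ)).trans hκN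
  have hκta' := abs_le.1 hκta
  have hsqrt : ovalRadius κ x Y b ≤ t ↔
      p ≤ √(p ^ 2 - (1 - κ ^ 2) * ((b - t) ^ 2 - (κ * N) ^ 2)) := by
    rw [ovalRadius, div_le_iff₀ hk, hdisc, hp]
    constructor <;> intro h <;> linarith
  have hq : (1 - κ ^ 2) * ((b - t) ^ 2 - (κ * N) ^ 2) ≤ 0 ↔ |b - t| ≤ κ * N := by
    rw [← not_lt, mul_pos_iff_of_pos_left hk, not_lt, sub_nonpos, ← sq_abs (b - t),
      sq_le_sq₀ (abs_nonneg _) (by positivity)]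
  rw [hsqrt, le_sqrt_sq_sub_iff, hq, abs_le]
  constructor
  · rintro (h | h) <;> linarith
  · intro h
    rcases le_or_gt (-(κ * N)) (b - t) with h' | h'
    · exact .inr ⟨h', by linarith⟩
    · left; linarith

lemma mem_subdiff_iff (hκ0 : 0 < κ) (hκ1 : κ < 1) (hc₁ : 0 < c₁) (hΩ : Ω ⊆ unitSphere n)
    (hu : ∀ x ∈ Ω, u x ∈ Icc c₁ c₂) {x₀ Y : Rn n} :
    Y ∈ subdiff κ Ω S u x₀ ↔
      Y ∈ S ∧ ∀ x ∈ Ω, opticalPath κ (u x₀ • x₀) Y ≤ opticalPath κ (u x • x) Y := by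
  refine and_congr_right fun _ => forall₂_congr fun x hx => ?_
  have hux : 0 ≤ u x := hc₁.le.trans (hu x hx).1
  rw [ovalThrough, ovalRadius_le_iff hκ0 hκ1 (norm_eq_one_of_mem hΩ hx), opticalPath, opticalPath,
    norm_smul (u x) x, norm_eq_one_of_mem hΩ hx, Real.norm_of_nonneg hux, mul_one]

lemma IsRefractor.abs_sub_le (hκ0 : 0 < κ) (hκ1 : κ < 1) (hc₁ : 0 < c₁) (hΩ : Ω ⊆ unitSphere n)
    (hu : IsRefractor κ c₁ c₂ Ω S u) {x y : Rn n} (hx : x ∈ Ω) (hy : y ∈ Ω) :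
    |u x - u y| ≤ κ * c₂ / (1 - κ) * ‖x - y‖ := by
  wlog hle : u y ≤ u x generalizing x y
  · rw [abs_sub_comm, norm_sub_rev]
    exact this hy hx (le_of_not_ge hle)
  have hx1 := norm_eq_one_of_mem hΩ hx
  have hy1 := norm_eq_one_of_mem hΩ hy
  have hux : 0 ≤ u x := hc₁.le.trans (hu.1 x hx).1
  have huy : 0 ≤ u y := hc₁.le.trans (hu.1 y hy).1
  obtain ⟨Y, hY⟩ := hu.2 x hx
  have hsupport := ((mem_subdiff_iff hκ0 hκ1 hc₁ hΩ hu.1).1 hY).2 y hy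
  simp only [opticalPath, norm_smul, hx1, hy1, Real.norm_of_nonneg, hux, huy, mul_one] at hsupport
  have htriangle : ‖u y • y - Y‖ ≤ ‖u y • y - u x • x‖ + ‖u x • x - Y‖ :=
    norm_sub_le_norm_sub_add_norm_sub _ _ _
  have hdist : ‖u y • y - u x • x‖ ≤ (u x - u y) + c₂ * ‖x - y‖ := by
    refine (norm_smul_sub_smul_le _ _ _ _).trans ?_
    rw [hy1, mul_one, abs_sub_comm, abs_of_nonneg (sub_nonneg.2 hle), abs_of_nonneg hux,
      norm_sub_rev y x]
    gcongr
    exact (hu.1 x hx).2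
  rw [abs_of_nonneg (sub_nonneg.2 hle), div_mul_eq_mul_div, le_div_iff₀ (by linarith)]
  nlinarith

lemma IsRefractor.norm_smul_sub_smul_le (hκ0 : 0 < κ) (hκ1 : κ < 1) (hc₁ : 0 < c₁)
    (hΩ : Ω ⊆ unitSphere n) (hu : IsRefractor κ c₁ c₂ Ω S u) {x y : Rn n} (hx : x ∈ Ω)
    (hy : y ∈ Ω) : ‖u x • x - u y • y‖ ≤ (κ * c₂ / (1 - κ) + c₂) * ‖x - y‖ := by
  refine (NearField.norm_smul_sub_smul_le _ _ _ _).trans ?_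
  have hu_y := hu.1 y hy
  rw [norm_eq_one_of_mem hΩ hx, mul_one, abs_of_nonneg (hc₁.le.trans hu_y.1), add_mul]
  gcongr
  exacts [hu.abs_sub_le hκ0 hκ1 hc₁ hΩ hx hy, hu_y.2]

lemma IsRefractor.continuousOn (hκ0 : 0 < κ) (hκ1 : κ < 1) (hc₁ : 0 < c₁)
    (hΩ : Ω ⊆ unitSphere n) (hu : IsRefractor κ c₁ c₂ Ω S u) : ContinuousOn u Ω := by
  refine LipschitzOnWith.continuousOn (K := (κ * c₂ / (1 - κ)).toNNReal)
    (LipschitzOnWith.of_dist_le_mul fun x hx y hy => ?_)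
  rw [Real.dist_eq, dist_eq_norm]
  refine (hu.abs_sub_le hκ0 hκ1 hc₁ hΩ hx hy).trans ?_
  gcongr
  exact Real.le_coe_toNNReal _

/-! ### Directions and the curves on the sphere -/

lemma norm_smul_dir (v : Rn n) : ‖v‖ • dir v = v := by
  rcases eq_or_ne v 0 with rfl | hv
  · simp
  · rw [dir, smul_inv_smul₀ (norm_ne_zero_iff.2 hv)]

lemma norm_dir {v : Rn n} (hv : v ≠ 0) : ‖dir v‖ = 1 := by
  rw [dir, norm_smul, norm_inv, norm_norm, inv_mul_cancel₀ (norm_ne_zero_iff.2 hv)]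

lemma dir_smul {x : Rn n} (hx : ‖x‖ = 1) {r : ℝ} (hr : 0 < r) : dir (r • x) = x := by
  rw [dir, norm_smul, hx, Real.norm_of_nonneg hr.le, mul_one, inv_smul_smul₀ hr.ne']

lemma dir_of_norm_eq_one {x : Rn n} (hx : ‖x‖ = 1) : dir x = x := by
  simp [dir, hx]

lemma norm_dir_sub_dir_le {a b : Rn n} (ha : a ≠ 0) (hb : b ≠ 0) :
    ‖dir a - dir b‖ ≤ 2 / ‖a‖ * ‖a - b‖ := by
  have ha' : 0 < ‖a‖ := norm_pos_iff.2 ha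
  have h : ‖a‖ • (dir a - dir b) = (a - b) + (‖b‖ - ‖a‖) • dir b := by
    rw [smul_sub, sub_smul, norm_smul_dir, norm_smul_dir]; abel
  have hnorm : ‖a‖ * ‖dir a - dir b‖ ≤ 2 * ‖a - b‖ := by
    rw [← norm_smul_of_nonneg ha'.le, h]
    refine (norm_add_le _ _).trans ?_
    rw [norm_smul, norm_dir hb, mul_one, Real.norm_eq_abs, two_mul, norm_sub_rev a b]
    gcongr
    exact abs_norm_sub_norm_le b a
  rw [div_mul_eq_mul_div, le_div_iff₀ ha']
  linarith

lemma mem_Gam_iff (hΩ : Ω ⊆ unitSphere n) (hc₁ : 0 < c₁) {X : Rn n} :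
    X ∈ Gam Ω c₁ c₂ ↔ dir X ∈ Ω ∧ ‖X‖ ∈ Icc c₁ c₂ := by
  constructor
  · rintro ⟨x, hx, r, hr₁, hr₂, rfl⟩
    have hx1 := norm_eq_one_of_mem hΩ hx
    have hr : 0 < r := hc₁.trans_le hr₁
    rw [dir_smul hx1 hr, norm_smul, hx1, mul_one, Real.norm_of_nonneg hr.le]
    exact ⟨hx, hr₁, hr₂⟩
  · rintro ⟨hx, hr₁, hr₂⟩
    exact ⟨dir X, hx, ‖X‖, hr₁, hr₂, (norm_smul_dir X).symm⟩

lemma smul_mem_Gam {x : Rn n} (hx : x ∈ Ω) {r : ℝ} (hr : r ∈ Icc c₁ c₂) : r • x ∈ Gam Ω c₁ c₂ :=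
  ⟨x, hx, r, hr.1, hr.2, rfl⟩

lemma IsRefractor.smul_mem_Gam (hu : IsRefractor κ c₁ c₂ Ω S u) {x : Rn n} (hx : x ∈ Ω) :
    u x • x ∈ Gam Ω c₁ c₂ :=
  NearField.smul_mem_Gam hx (hu.1 x hx)

lemma norm_convexCombination_sq {V : Type*} [NormedAddCommGroup V] [InnerProductSpace ℝ V]
    {a b : V} (ha : ‖a‖ = 1) (hb : ‖b‖ = 1) (l : ℝ) :
    ‖(1 - l) • a + l • b‖ ^ 2 = 1 - l * (1 - l) * ‖a - b‖ ^ 2 := by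
  rw [norm_add_sq_real, norm_sub_sq_real, norm_smul, norm_smul, real_inner_smul_left,
    real_inner_smul_right, ha, hb, mul_one, mul_one, Real.norm_eq_abs, Real.norm_eq_abs, sq_abs,
    sq_abs]
  ring

lemma norm_convexCombination_le {V : Type*} [SeminormedAddCommGroup V] [NormedSpace ℝ V]
    {a b : V} (ha : ‖a‖ = 1) (hb : ‖b‖ = 1) {l : ℝ} (hl : l ∈ Icc (0 : ℝ) 1) :
    ‖(1 - l) • a + l • b‖ ≤ 1 := by
  have h := convex_closedBall (0 : V) 1 (mem_closedBall_zero_iff.2 ha.le)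
    (mem_closedBall_zero_iff.2 hb.le) (sub_nonneg.2 hl.2) hl.1 (sub_add_cancel 1 l)
  exact mem_closedBall_zero_iff.1 h

lemma smaller_root_mem_Icc {a N : ℝ} (hκ0 : 0 < κ) (hκ1 : κ < 1) (haN : |a| ≤ N)
    (h : 1 + 2 * κ * a + κ ^ 2 * N ^ 2 ≤ κ ^ 2) :
    (-a - √(a ^ 2 - (1 - κ ^ 2) * N ^ 2)) / (κ * N ^ 2) ∈ Icc (0 : ℝ) 1 := by
  have hk : 0 < 1 - κ ^ 2 := by nlinarith
  have ha : a < 0 := by nlinarith [mul_nonneg (sq_nonneg κ) (sq_nonneg N)]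
  have hN : 0 < N := (abs_pos.2 ha.ne).trans_le haN
  constructor
  · refine div_nonneg (sub_nonneg.2 (Real.sqrt_le_iff.2 ⟨by linarith, ?_⟩)) (by positivity)
    nlinarith [mul_nonneg hk.le (sq_nonneg N)]
  · have : -a - κ * N ^ 2 ≤ √(a ^ 2 - (1 - κ ^ 2) * N ^ 2) := by
      refine Real.le_sqrt_of_sq_le ?_
      nlinarith [mul_le_mul_of_nonneg_right h (sq_nonneg N)]
    rw [div_le_one (by positivity)]
    linarith

section Curve

variable {x₀ m₁ m₂ : Rn n} {l : ℝ}

lemma betaCoef_mem_Icc (hκ0 : 0 < κ) (hκ1 : κ < 1) (hx : ‖x₀‖ = 1) (h₁ : ‖m₁‖ = 1)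
    (h₂ : ‖m₂‖ = 1) (hl : l ∈ Icc (0 : ℝ) 1) : betaCoef κ x₀ m₁ m₂ l ∈ Icc (0 : ℝ) 1 := by
  set ξ := chordVec κ x₀ m₁ m₂ l with hξ
  have hcs : |(inner ℝ x₀ ξ : ℝ)| ≤ ‖ξ‖ := by
    simpa only [hx, one_mul] using abs_real_inner_le_norm x₀ ξ
  have hchord : x₀ + κ • ξ = κ • ((1 - l) • m₁ + l • m₂) := by
    rw [hξ, chordVec, smul_sub, smul_inv_smul₀ hκ0.ne', add_sub_cancel]
  have hnorm : ‖x₀ + κ • ξ‖ ^ 2 ≤ κ ^ 2 := by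
    rw [hchord, norm_smul, Real.norm_of_nonneg hκ0.le]
    have := norm_convexCombination_le h₁ h₂ hl
    gcongr
    exact mul_le_of_le_one_right hκ0.le this
  rw [norm_add_sq_real, hx, real_inner_smul_right, norm_smul, Real.norm_of_nonneg hκ0.le,
    mul_pow] at hnorm
  exact smaller_root_mem_Icc hκ0 hκ1 hcs (by linarith)

lemma curvePt_eq : curvePt κ x₀ m₁ m₂ l =
    ((1 - l) * betaCoef κ x₀ m₁ m₂ l) • m₁ + (l * betaCoef κ x₀ m₁ m₂ l) • m₂ +
      (1 - betaCoef κ x₀ m₁ m₂ l) • κ⁻¹ • x₀ := by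
  rw [curvePt, chordVec]; module

lemma mul_norm_sub_sq_le_one_sub_betaCoef (hκ0 : 0 < κ) (hκ1 : κ < 1) (hx : ‖x₀‖ = 1)
    (h₁ : ‖m₁‖ = 1) (h₂ : ‖m₂‖ = 1) (hl : l ∈ Icc (0 : ℝ) 1)
    (hm : ‖curvePt κ x₀ m₁ m₂ l‖ = 1) :
    l * (1 - l) * ‖m₁ - m₂‖ ^ 2 ≤ 2 * (1 + κ⁻¹) * (1 - betaCoef κ x₀ m₁ m₂ l) := by
  have hβ : 0 ≤ 1 - betaCoef κ x₀ m₁ m₂ l :=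
    sub_nonneg.2 (betaCoef_mem_Icc hκ0 hκ1 hx h₁ h₂ hl).2
  set v := (1 - l) • m₁ + l • m₂ with hv
  have hv1 : ‖v‖ ≤ 1 := norm_convexCombination_le h₁ h₂ hl
  have hvsq : ‖v‖ ^ 2 = 1 - l * (1 - l) * ‖m₁ - m₂‖ ^ 2 := norm_convexCombination_sq h₁ h₂ l
  have hξ : ‖chordVec κ x₀ m₁ m₂ l‖ ≤ 1 + κ⁻¹ := by
    refine (norm_sub_le _ _).trans (add_le_add hv1 ?_)
    rw [norm_smul, hx, Real.norm_of_nonneg (inv_nonneg.2 hκ0.le), mul_one]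
  have hsub : curvePt κ x₀ m₁ m₂ l - v =
      -((1 - betaCoef κ x₀ m₁ m₂ l) • chordVec κ x₀ m₁ m₂ l) := by
    rw [curvePt, hv, chordVec]; module
  have hdist : ‖curvePt κ x₀ m₁ m₂ l‖ - ‖v‖ ≤ (1 - betaCoef κ x₀ m₁ m₂ l) * (1 + κ⁻¹) := by
    refine (norm_sub_norm_le _ v).trans ?_
    rw [hsub, norm_neg, norm_smul, Real.norm_of_nonneg hβ]
    exact mul_le_mul_of_nonneg_left hξ hβ
  rw [hm] at hdist
  nlinarith [norm_nonneg v]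

end Curve

end

/-! ### The target seen from a point of `Γ` -/

section

variable {n : ℕ} {κ c₁ c₂ : ℝ} {Ω S : Set (Rn n)} {E : Rn n → Set (Rn n)}
  {s : Rn n → Rn n → ℝ}

section Target

variable {X Y Y₁ Y₂ : Rn n} {l : ℝ}

lemma HypA.exists_polar (hA : HypA κ c₁ c₂ Ω S E s) (hX : X ∈ Gam Ω c₁ c₂) (hY : Y ∈ S) :
    Y ≠ X ∧ dir (Y - X) ∈ E X ∧ s X (dir (Y - X)) = ‖Y - X‖ := by
  obtain ⟨m, hm, rfl⟩ := hA.graph X hX ▸ hY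
  have hs := hA.pos X hX m hm
  have hm1 := mem_sphere_zero_iff_norm.1 (hA.directions X hX hm).1
  rw [← sub_ne_zero, add_sub_cancel_left, dir_smul hm1 hs, norm_smul, hm1,
    Real.norm_of_nonneg hs.le, mul_one]
  exact ⟨smul_ne_zero hs.ne' (norm_ne_zero_iff.1 (hm1 ▸ one_ne_zero)), hm, rfl⟩

lemma HypA.ne (hA : HypA κ c₁ c₂ Ω S E s) (hX : X ∈ Gam Ω c₁ c₂) (hY : Y ∈ S) : Y ≠ X :=
  (hA.exists_polar hX hY).1

lemma HypA.norm_dir_sub (hA : HypA κ c₁ c₂ Ω S E s) (hX : X ∈ Gam Ω c₁ c₂) (hY : Y ∈ S) :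
    ‖dir (Y - X)‖ = 1 :=
  norm_dir (sub_ne_zero.2 (hA.ne hX hY))

lemma HypA.curvePt_mem (hA : HypA κ c₁ c₂ Ω S E s) (hX : X ∈ Gam Ω c₁ c₂) (h₁ : Y₁ ∈ S)
    (h₂ : Y₂ ∈ S) (hl : l ∈ Icc (0 : ℝ) 1) :
    curvePt κ (dir X) (dir (Y₁ - X)) (dir (Y₂ - X)) l ∈ E X :=
  hA.convex X hX _ (hA.exists_polar hX h₁).2.1 _ (hA.exists_polar hX h₂).2.1 l hl

lemma HypA.norm_curvePt (hA : HypA κ c₁ c₂ Ω S E s) (hX : X ∈ Gam Ω c₁ c₂) (h₁ : Y₁ ∈ S)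
    (h₂ : Y₂ ∈ S) (hl : l ∈ Icc (0 : ℝ) 1) :
    ‖curvePt κ (dir X) (dir (Y₁ - X)) (dir (Y₂ - X)) l‖ = 1 :=
  mem_sphere_zero_iff_norm.1 (hA.directions X hX (hA.curvePt_mem hX h₁ h₂ hl)).1

lemma HypA.targetCurvePt_mem (hA : HypA κ c₁ c₂ Ω S E s) (hX : X ∈ Gam Ω c₁ c₂) (h₁ : Y₁ ∈ S)
    (h₂ : Y₂ ∈ S) (hl : l ∈ Icc (0 : ℝ) 1) : targetCurvePt κ s X Y₁ Y₂ l ∈ S := by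
  rw [hA.graph X hX]
  exact mem_image_of_mem _ (hA.curvePt_mem hX h₁ h₂ hl)

lemma HypA.dir_targetCurvePt_sub (hA : HypA κ c₁ c₂ Ω S E s) (hX : X ∈ Gam Ω c₁ c₂)
    (h₁ : Y₁ ∈ S) (h₂ : Y₂ ∈ S) (hl : l ∈ Icc (0 : ℝ) 1) :
    dir (targetCurvePt κ s X Y₁ Y₂ l - X) =
      curvePt κ (dir X) (dir (Y₁ - X)) (dir (Y₂ - X)) l := by
  rw [targetCurvePt, add_sub_cancel_left, dir_smul (hA.norm_curvePt hX h₁ h₂ hl)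
    (hA.pos X hX _ (hA.curvePt_mem hX h₁ h₂ hl))]

lemma HypB.two_mul_div_le_norm_sub (hB : HypB κ c₁ c₂ Ω S) (hκ : 0 < κ) (hc₁ : 0 < c₁)
    (hΩ : Ω ⊆ unitSphere n) (hA : HypA κ c₁ c₂ Ω S E s) (hX : X ∈ Gam Ω c₁ c₂) (hY : Y ∈ S) :
    2 * (c₂ / κ) ≤ ‖Y - X‖ := by
  obtain ⟨hx, hr⟩ := (mem_Gam_iff hΩ hc₁).1 hX
  have hc₂ : 0 < c₂ := hc₁.trans_le (hr.1.trans hr.2)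
  have hx1 := norm_eq_one_of_mem hΩ hx
  set X' := c₂ • dir X
  have hX' : X' ∈ Gam Ω c₁ c₂ := ⟨dir X, hx, c₂, hr.1.trans hr.2, le_rfl, rfl⟩
  have hsqrt : √(1 + ((1 + κ) ^ 2)⁻¹) - 1 ≤ ((1 + κ) ^ 2)⁻¹ / 2 := by
    have hpos : 0 < ((1 + κ) ^ 2)⁻¹ := by positivity
    linarith [Real.sqrt_one_add_le (x := ((1 + κ) ^ 2)⁻¹) (by linarith)]
  have hfar : c₂ ≤ κ * (((1 + κ) ^ 2)⁻¹ / 2) * ‖Y - X'‖ := by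
    have h := hB X' hX' Y hY
    rw [div_le_iff₀ (norm_pos_iff.2 (sub_ne_zero.2 (hA.ne hX' hY))), norm_smul, hx1, mul_one,
      Real.norm_of_nonneg hc₂.le] at h
    exact h.trans (by gcongr)
  have hfar' : 2 * c₂ * (1 + κ) ^ 2 ≤ κ * ‖Y - X'‖ := by
    field_simp at hfar
    linarith
  have hXX' : ‖Y - X'‖ ≤ ‖Y - X‖ + c₂ := by
    refine (norm_sub_le_norm_sub_add_norm_sub Y X X').trans ?_
    gcongr
    have : X - X' = (‖X‖ - c₂) • dir X := by rw [sub_smul, norm_smul_dir]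
    rw [this, norm_smul, hx1, mul_one, Real.norm_eq_abs, abs_le]
    constructor <;> linarith [hr.1, hr.2]
  rw [← mul_div_assoc, div_le_iff₀ hκ]
  nlinarith [mul_le_mul_of_nonneg_left hXX' hκ.le, mul_nonneg hc₂.le (sq_nonneg κ),
    mul_pos hc₂ hκ]

lemma HypA.exists_norm_sub_le (hA : HypA κ c₁ c₂ Ω S E s) (hΩ : Ω ⊆ unitSphere n)
    (hc₁ : 0 < c₁) : ∃ R, 0 < R ∧ ∀ X ∈ Gam Ω c₁ c₂, ∀ Y ∈ S, ‖Y - X‖ ≤ R := by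
  obtain ⟨C, hC, hLip⟩ := hA.lipschitz
  rcases (Gam Ω c₁ c₂).eq_empty_or_nonempty with hΓ | ⟨X₀, hX₀⟩
  · exact ⟨1, one_pos, by simp [hΓ]⟩
  rcases S.eq_empty_or_nonempty with rfl | ⟨Y₀, hY₀⟩
  · exact ⟨1, one_pos, by simp⟩
  obtain ⟨-, hm₀, hs₀⟩ := hA.exists_polar hX₀ hY₀
  refine ⟨‖Y₀ - X₀‖ + C * 2 + (‖X₀‖ + c₂) + 1, ?_, fun X hX Y hY => ?_⟩
  · have hr := ((mem_Gam_iff hΩ hc₁).1 hX₀).2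
    have : 0 < c₂ := hc₁.trans_le (hr.1.trans hr.2)
    positivity
  · obtain ⟨-, hm, hs⟩ := hA.exists_polar hX₀ hY
    have hdir : ‖dir (Y - X₀) - dir (Y₀ - X₀)‖ ≤ 2 := by
      refine (norm_sub_le _ _).trans ?_
      rw [hA.norm_dir_sub hX₀ hY, hA.norm_dir_sub hX₀ hY₀, one_add_one_eq_two]
    have hradius : ‖Y - X₀‖ ≤ ‖Y₀ - X₀‖ + C * 2 := by
      have h := (le_abs_self _).trans (hLip X₀ hX₀ _ hm _ hm₀)
      rw [hs, hs₀] at h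
      linarith [mul_le_mul_of_nonneg_left hdir hC.le]
    calc ‖Y - X‖ ≤ ‖Y - X₀‖ + ‖X₀ - X‖ := norm_sub_le_norm_sub_add_norm_sub _ _ _
      _ ≤ (‖Y₀ - X₀‖ + C * 2) + (‖X₀‖ + c₂) :=
        add_le_add hradius ((norm_sub_le _ _).trans
          (by gcongr; exact ((mem_Gam_iff hΩ hc₁).1 hX).2.2))
      _ ≤ _ := (lt_add_one _).le

lemma HypA.exists_norm_sub_le_mul_dir_sub (hA : HypA κ c₁ c₂ Ω S E s) (hΩ : Ω ⊆ unitSphere n)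
    (hc₁ : 0 < c₁) : ∃ K, 0 < K ∧ ∀ X ∈ Gam Ω c₁ c₂, ∀ Y₁ ∈ S, ∀ Y₂ ∈ S,
      ‖Y₁ - Y₂‖ ≤ K * ‖dir (Y₁ - X) - dir (Y₂ - X)‖ := by
  obtain ⟨R, hR, hYR⟩ := hA.exists_norm_sub_le hΩ hc₁
  obtain ⟨K, hK, hLip⟩ := hA.lipschitz
  refine ⟨K + R, by positivity, fun X hX Y₁ hY₁ Y₂ hY₂ => ?_⟩
  obtain ⟨-, hm₁, hs₁⟩ := hA.exists_polar hX hY₁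
  obtain ⟨-, hm₂, hs₂⟩ := hA.exists_polar hX hY₂
  have hpolar := NearField.norm_smul_sub_smul_le ‖Y₁ - X‖ ‖Y₂ - X‖ (dir (Y₁ - X)) (dir (Y₂ - X))
  rw [norm_smul_dir, norm_smul_dir, sub_sub_sub_cancel_right, hA.norm_dir_sub hX hY₁, mul_one,
    abs_norm] at hpolar
  have hradius := hLip X hX _ hm₁ _ hm₂
  rw [hs₁, hs₂] at hradius
  rw [add_mul]
  exact hpolar.trans (add_le_add hradius
    (mul_le_mul_of_nonneg_right (hYR X hX Y₂ hY₂) (norm_nonneg _)))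

end Target

/-! ### Strict quasiconvexity of the optical path along target curves -/

section PathDefect

variable {V : Type*} [NormedAddCommGroup V] [InnerProductSpace ℝ V]

/-- Up to a positive factor this is the difference of the optical paths to `Y` through `X` and
through `X₀`, where `w = X - X₀`, `d = (|X₀| - |X|) / κ`, and `Y` is the point in direction `m` and
at distance `i⁻¹` from `X₀`. The point of this normalization is that it is affine in `(m, i)`. -/
def pathDefect (w : V) (d : ℝ) (m : V) (i : ℝ) : ℝ :=
  (‖w‖ ^ 2 - d ^ 2) / 2 * i - (inner ℝ w m + d)

lemma pathDefect_affine (w : V) (d : ℝ) {a₁ a₂ a₀ : ℝ} (ha : a₁ + a₂ + a₀ = 1) (m₁ m₂ p : V)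
    (i₁ i₂ i₀ : ℝ) :
    pathDefect w d (a₁ • m₁ + a₂ • m₂ + a₀ • p) (a₁ * i₁ + a₂ * i₂ + a₀ * i₀) =
      a₁ * pathDefect w d m₁ i₁ + a₂ * pathDefect w d m₂ i₂ + a₀ * pathDefect w d p i₀ := by
  simp only [pathDefect, inner_add_right, real_inner_smul_right]
  linear_combination d * ha

variable {w m₁ m₂ p : V} {d ν e a₁ a₂ a₀ i₁ i₂ i : ℝ}

lemma le_pathDefect_of_nonneg {θ : ℝ} (h₁ : 0 ≤ a₁) (h₂ : 0 ≤ a₂) (h₀ : 0 ≤ a₀)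
    (ha : a₁ + a₂ + a₀ = 1) (hA : 0 ≤ ‖w‖ ^ 2 - d ^ 2) (he : 0 ≤ e)
    (he₁ : -e ≤ pathDefect w d m₁ i₁) (he₂ : -e ≤ pathDefect w d m₂ i₂)
    (hp : θ ≤ pathDefect w d p (-ν)) (hi : a₁ * (i₁ + ν) + a₂ * (i₂ + ν) ≤ i + ν) :
    a₀ * θ - e ≤ pathDefect w d (a₁ • m₁ + a₂ • m₂ + a₀ • p) i := by
  have hmono : a₁ * i₁ + a₂ * i₂ + a₀ * -ν ≤ i := by
    linear_combination hi - ν * ha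
  calc a₀ * θ - e
      ≤ a₁ * pathDefect w d m₁ i₁ + a₂ * pathDefect w d m₂ i₂ +
          a₀ * pathDefect w d p (-ν) := by
        nlinarith [mul_le_mul_of_nonneg_left he₁ h₁, mul_le_mul_of_nonneg_left he₂ h₂,
          mul_le_mul_of_nonneg_left hp h₀, mul_nonneg h₀ he]
    _ = pathDefect w d (a₁ • m₁ + a₂ • m₂ + a₀ • p) (a₁ * i₁ + a₂ * i₂ + a₀ * -ν) :=
        (pathDefect_affine w d ha ..).symm
    _ ≤ _ := by unfold pathDefect; gcongr

-- For `0 ≤ d` the defect at `(m₁, i₁)` bounds `d - ‖w‖`; for `d ≤ 0` the quadratic term only helps.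
lemma neg_le_mul_or_half_pathDefect_le {m : V} {D : ℝ} (hA : ‖w‖ ^ 2 - d ^ 2 < 0)
    (hm₁ : ‖m₁‖ = 1) (hm : ‖m‖ = 1) (hd : |d| ≤ D) (hi₁ : 0 ≤ i₁) (hi : 0 ≤ i)
    (hiD : i * (2 * D) ≤ 1) (he : 0 ≤ e) (he₁ : -e ≤ pathDefect w d m₁ i₁) :
    -(e / 2) ≤ (‖w‖ ^ 2 - d ^ 2) / 2 * i ∨ pathDefect w d m 0 / 2 ≤ pathDefect w d m i := by
  have hwd : ‖w‖ ≤ |d| := by simpa only [abs_norm] using sq_le_sq.1 (sub_neg.1 hA).le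
  have hinner {v : V} (hv : ‖v‖ = 1) : |inner ℝ w v| ≤ ‖w‖ := by
    simpa only [hv, mul_one] using abs_real_inner_le_norm w v
  rcases le_total 0 d with hd0 | hd0
  · left
    rw [abs_of_nonneg hd0] at hwd hd
    have hgap : d - ‖w‖ ≤ e := by
      have := mul_nonpos_of_nonpos_of_nonneg (div_neg_of_neg_of_pos hA two_pos).le hi₁
      unfold pathDefect at he₁
      linarith [(abs_le.1 (hinner hm₁)).1]
    have : (d - ‖w‖) * ((d + ‖w‖) * i) ≤ e * 1 :=
      mul_le_mul hgap (by nlinarith) (by positivity) he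
    linarith
  · right
    rw [abs_of_nonpos hd0] at hwd hd
    have : 0 ≤ (-d - ‖w‖) * (1 - (‖w‖ - d) * i) :=
      mul_nonneg (sub_nonneg.2 hwd) (by nlinarith)
    unfold pathDefect
    linarith [(abs_le.1 (hinner hm)).2]

lemma le_pathDefect {D θ : ℝ} (h₁ : 0 ≤ a₁) (h₂ : 0 ≤ a₂) (h₀ : 0 ≤ a₀)
    (ha : a₁ + a₂ + a₀ = 1) (hm₁ : ‖m₁‖ = 1) (hm : ‖a₁ • m₁ + a₂ • m₂ + a₀ • p‖ = 1)
    (hd : |d| ≤ D) (hi₁ : 0 ≤ i₁) (hi₂ : 0 ≤ i₂) (hi : 0 ≤ i) (hiD : i * (2 * D) ≤ 1)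
    (he : 0 ≤ e) (he₁ : -e ≤ pathDefect w d m₁ i₁) (he₂ : -e ≤ pathDefect w d m₂ i₂)
    (hθ : 0 ≤ θ) (hp₀ : θ ≤ pathDefect w d p 0) (hpν : θ ≤ pathDefect w d p (-ν))
    (hconc : a₁ * (i₁ + ν) + a₂ * (i₂ + ν) ≤ i + ν) :
    a₀ * θ / 2 - 2 * e ≤ pathDefect w d (a₁ • m₁ + a₂ • m₂ + a₀ • p) i := by
  have hθ' : 0 ≤ a₀ * θ := mul_nonneg h₀ hθ
  rcases le_or_gt 0 (‖w‖ ^ 2 - d ^ 2) with hA | hA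
  · linarith [le_pathDefect_of_nonneg h₁ h₂ h₀ ha hA he he₁ he₂ hpν hconc]
  set m := a₁ • m₁ + a₂ • m₂ + a₀ • p
  have hm0 : a₀ * θ - e ≤ pathDefect w d m 0 := by
    calc a₀ * θ - e
        ≤ a₁ * pathDefect w d m₁ i₁ + a₂ * pathDefect w d m₂ i₂ +
            a₀ * pathDefect w d p 0 := by
          nlinarith [mul_le_mul_of_nonneg_left he₁ h₁, mul_le_mul_of_nonneg_left he₂ h₂,
            mul_le_mul_of_nonneg_left hp₀ h₀, mul_nonneg h₀ he]
      _ = pathDefect w d m (a₁ * i₁ + a₂ * i₂ + a₀ * 0) := (pathDefect_affine w d ha ..).symm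
      _ ≤ pathDefect w d m 0 := by
          have : 0 ≤ a₁ * i₁ + a₂ * i₂ := by positivity
          unfold pathDefect
          nlinarith
  rcases neg_le_mul_or_half_pathDefect_le hA hm₁ hm hd hi₁ hi hiD he he₁ with h | h
  · have : pathDefect w d m i = (‖w‖ ^ 2 - d ^ 2) / 2 * i + pathDefect w d m 0 := by
      unfold pathDefect
      ring
    linarith
  · linarith

lemma opticalPath_sub_mul {X X₀ Y : V} (hd : κ * d = ‖X₀‖ - ‖X‖) (hY : Y ≠ X₀) :
    (opticalPath κ X Y - opticalPath κ X₀ Y) * (‖X - Y‖ + ‖Y - X₀‖ + d) =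
      2 * κ * ‖Y - X₀‖ *
        pathDefect (X - X₀) d (‖Y - X₀‖⁻¹ • (Y - X₀)) ‖Y - X₀‖⁻¹ := by
  have hs : ‖Y - X₀‖ ≠ 0 := norm_ne_zero_iff.2 (sub_ne_zero.2 hY)
  have hcos : ‖X - Y‖ ^ 2 = ‖X - X₀‖ ^ 2 - 2 * inner ℝ (X - X₀) (Y - X₀) + ‖Y - X₀‖ ^ 2 := by
    rw [← norm_sub_sq_real, sub_sub_sub_cancel_right]
  have hdiff : opticalPath κ X Y - opticalPath κ X₀ Y =
      κ * (‖X - Y‖ - ‖Y - X₀‖ - d) := by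
    rw [opticalPath, opticalPath, norm_sub_rev X₀ Y]
    linear_combination hd
  rw [hdiff, pathDefect, real_inner_smul_right]
  field_simp
  linear_combination κ * hcos

end PathDefect

lemma abs_norm_sub_norm_div_le (hκ : 0 < κ) (hc₁ : 0 < c₁) (hΩ : Ω ⊆ unitSphere n) {X X₀ : Rn n}
    (hX₀ : X₀ ∈ Gam Ω c₁ c₂) (hX : X ∈ Gam Ω c₁ c₂) : |(‖X₀‖ - ‖X‖) / κ| ≤ c₂ / κ := by
  obtain ⟨-, hr⟩ := (mem_Gam_iff hΩ hc₁).1 hX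
  obtain ⟨-, hr₀⟩ := (mem_Gam_iff hΩ hc₁).1 hX₀
  rw [abs_div, abs_of_pos hκ]
  gcongr
  rw [abs_le]
  constructor <;> linarith [hr.1, hr.2, hr₀.1, hr₀.2]

lemma exists_opticalPath_sub_eq_mul_pathDefect (hκ : 0 < κ) (hc₁ : 0 < c₁) (hc₂ : 0 < c₂)
    (hΩ : Ω ⊆ unitSphere n) (hA : HypA κ c₁ c₂ Ω S E s) (hB : HypB κ c₁ c₂ Ω S) :
    ∃ a b : ℝ, 0 < a ∧ 0 < b ∧ ∀ X₀ ∈ Gam Ω c₁ c₂, ∀ X ∈ Gam Ω c₁ c₂, ∀ Y ∈ S,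
      ∃ F ∈ Icc a b, opticalPath κ X Y - opticalPath κ X₀ Y =
        F * pathDefect (X - X₀) ((‖X₀‖ - ‖X‖) / κ) (dir (Y - X₀)) ‖Y - X₀‖⁻¹ := by
  obtain ⟨R, hR, hYR⟩ := hA.exists_norm_sub_le hΩ hc₁
  set D := c₂ / κ
  have hD : 0 < D := div_pos hc₂ hκ
  refine ⟨2 * κ * (2 * D) / (3 * R), 2 * κ * R / D, by positivity, by positivity,
    fun X₀ hX₀ X hX Y hY => ?_⟩
  set d := (‖X₀‖ - ‖X‖) / κ
  have hd : |d| ≤ D := abs_norm_sub_norm_div_le hκ hc₁ hΩ hX₀ hX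
  have hlow := hB.two_mul_div_le_norm_sub hκ hc₁ hΩ hA hX₀ hY
  have hσ : D ≤ ‖X - Y‖ + ‖Y - X₀‖ + d := by
    linarith [(abs_le.1 hd).1, norm_nonneg (X - Y)]
  have hσ' : ‖X - Y‖ + ‖Y - X₀‖ + d ≤ 3 * R := by
    linarith [(abs_le.1 hd).2, hYR X₀ hX₀ Y hY, norm_sub_rev X Y ▸ hYR X hX Y hY]
  have hσ0 : 0 < ‖X - Y‖ + ‖Y - X₀‖ + d := hD.trans_le hσ
  refine ⟨2 * κ * ‖Y - X₀‖ / (‖X - Y‖ + ‖Y - X₀‖ + d), ⟨?_, ?_⟩, ?_⟩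
  · gcongr
  · gcongr
    exact hYR X₀ hX₀ Y hY
  · have := opticalPath_sub_mul (mul_div_cancel₀ (‖X₀‖ - ‖X‖) hκ.ne') (hA.ne hX₀ hY)
    rw [div_mul_eq_mul_div, eq_div_iff hσ0.ne']
    exact this

lemma norm_sub_sq_eq_add_dir {X X₀ : Rn n} (hX : X ≠ 0) (hX₀ : X₀ ≠ 0) :
    ‖X - X₀‖ ^ 2 = (‖X‖ - ‖X₀‖) ^ 2 + ‖X‖ * ‖X₀‖ * ‖dir X - dir X₀‖ ^ 2 := by
  have hinner : inner ℝ X X₀ = ‖X‖ * ‖X₀‖ * inner ℝ (dir X) (dir X₀) := by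
    rw [mul_assoc, ← real_inner_smul_right, ← real_inner_smul_left, norm_smul_dir, norm_smul_dir]
  rw [norm_sub_sq_real, norm_sub_sq_real, norm_dir hX, norm_dir hX₀, hinner]
  ring

lemma pathDefect_inv_smul_dir_zero {X X₀ : Rn n} (hκ : κ ≠ 0) (hX : X ≠ 0) (hX₀ : X₀ ≠ 0) :
    pathDefect (X - X₀) ((‖X₀‖ - ‖X‖) / κ) (κ⁻¹ • dir X₀) 0 =
      ‖X‖ * ‖dir X - dir X₀‖ ^ 2 / (2 * κ) := by
  have h₁ : inner ℝ X (dir X₀) = ‖X‖ * inner ℝ (dir X) (dir X₀) := by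
    rw [← real_inner_smul_left, norm_smul_dir]
  have h₂ : inner ℝ X₀ (dir X₀) = ‖X₀‖ := by
    nth_rw 1 [← norm_smul_dir X₀]
    rw [real_inner_smul_left, real_inner_self_eq_norm_sq, norm_dir hX₀, one_pow, mul_one]
  rw [pathDefect, real_inner_smul_right, inner_sub_left, h₁, h₂, norm_sub_sq_real (dir X),
    norm_dir hX, norm_dir hX₀]
  field_simp
  ring

lemma mul_le_pathDefect_inv_smul_dir {X X₀ : Rn n} {μ : ℝ} (hκ0 : 0 < κ) (hκ1 : κ < 1)
    (hμ0 : 0 ≤ μ) (hμ : μ ≤ κ) (hX : X ≠ 0) (hX₀ : X₀ ≠ 0) :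
    (1 - κ ^ 2) * (‖X‖ * ‖dir X - dir X₀‖ ^ 2 / (2 * κ)) ≤
      pathDefect (X - X₀) ((‖X₀‖ - ‖X‖) / κ) (κ⁻¹ • dir X₀) (-(μ / ‖X₀‖)) := by
  have : 0 < ‖X₀‖ := norm_pos_iff.2 hX₀
  have hT := pathDefect_inv_smul_dir_zero hκ0.ne' hX hX₀
  set T := ‖X‖ * ‖dir X - dir X₀‖ ^ 2 / (2 * κ) with hTdef
  set d := (‖X₀‖ - ‖X‖) / κ with hd
  have : 0 ≤ T := by positivity
  have hquad : (‖X - X₀‖ ^ 2 - d ^ 2) / 2 ≤ κ * ‖X₀‖ * T := by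
    have hκT : κ * ‖X₀‖ * T = ‖X‖ * ‖X₀‖ * ‖dir X - dir X₀‖ ^ 2 / 2 := by
      rw [hTdef]
      field_simp
    have hd2 : (‖X‖ - ‖X₀‖) ^ 2 ≤ d ^ 2 := by
      have : (‖X‖ - ‖X₀‖) ^ 2 = κ ^ 2 * d ^ 2 := by
        rw [hd]
        field_simp
        ring
      rw [this]
      exact mul_le_of_le_one_left (sq_nonneg d) (pow_le_one₀ hκ0.le hκ1.le)
    rw [hκT, norm_sub_sq_eq_add_dir hX hX₀]
    linarith
  have hκμ : (‖X - X₀‖ ^ 2 - d ^ 2) / 2 * (μ / ‖X₀‖) ≤ κ ^ 2 * T := by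
    calc (‖X - X₀‖ ^ 2 - d ^ 2) / 2 * (μ / ‖X₀‖)
        ≤ κ * ‖X₀‖ * T * (μ / ‖X₀‖) := by gcongr
      _ = κ * μ * T := by field_simp
      _ ≤ κ ^ 2 * T := by
          rw [sq]
          gcongr
  unfold pathDefect at hT ⊢
  linarith

lemma HypA.exists_mul_norm_sub_sq_le_one_sub_betaCoef (hκ0 : 0 < κ) (hκ1 : κ < 1) (hc₁ : 0 < c₁)
    (hΩ : Ω ⊆ unitSphere n) (hA : HypA κ c₁ c₂ Ω S E s) :
    ∃ c, 0 < c ∧ ∀ X ∈ Gam Ω c₁ c₂, ∀ Y₁ ∈ S, ∀ Y₂ ∈ S, ∀ l ∈ Icc (1 / 4 : ℝ) (3 / 4),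
      c * ‖Y₁ - Y₂‖ ^ 2 ≤ 1 - betaCoef κ (dir X) (dir (Y₁ - X)) (dir (Y₂ - X)) l := by
  obtain ⟨K, hK, hYK⟩ := hA.exists_norm_sub_le_mul_dir_sub hΩ hc₁
  refine ⟨1 / 8 / (2 * (1 + κ⁻¹)) / K ^ 2, by positivity,
    fun X hX Y₁ hY₁ Y₂ hY₂ l hl => ?_⟩
  have hl' : l ∈ Icc (0 : ℝ) 1 := Icc_subset_Icc (by norm_num) (by norm_num) hl
  have hx := norm_eq_one_of_mem hΩ ((mem_Gam_iff hΩ hc₁).1 hX).1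
  have hβ := mul_norm_sub_sq_le_one_sub_betaCoef hκ0 hκ1 hx (hA.norm_dir_sub hX hY₁)
    (hA.norm_dir_sub hX hY₂) hl' (hA.norm_curvePt hX hY₁ hY₂ hl')
  set m₁ := dir (Y₁ - X)
  set m₂ := dir (Y₂ - X)
  have hl8 : 1 / 8 ≤ l * (1 - l) := by
    nlinarith [mul_nonneg (sub_nonneg.2 hl.1) (sub_nonneg.2 hl.2)]
  rw [div_div, div_mul_eq_mul_div, div_le_iff₀ (by positivity)]
  calc 1 / 8 * ‖Y₁ - Y₂‖ ^ 2 ≤ 1 / 8 * (K * ‖m₁ - m₂‖) ^ 2 := by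
        gcongr
        exact hYK X hX Y₁ hY₁ Y₂ hY₂
    _ ≤ K ^ 2 * (l * (1 - l) * ‖m₁ - m₂‖ ^ 2) := by
        rw [mul_pow, mul_left_comm]
        gcongr
    _ ≤ K ^ 2 * (2 * (1 + κ⁻¹) * (1 - betaCoef κ (dir X) m₁ m₂ l)) := by gcongr
    _ = (1 - betaCoef κ (dir X) m₁ m₂ l) * (2 * (1 + κ⁻¹) * K ^ 2) := by ring

lemma exists_pathDefect_gain (hκ0 : 0 < κ) (hκ1 : κ < 1) (hc₁ : 0 < c₁)
    (hΩ : Ω ⊆ unitSphere n) (hA : HypA κ c₁ c₂ Ω S E s) (hB : HypB κ c₁ c₂ Ω S)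
    (hC : HypC κ c₁ c₂ Ω E s) :
    ∃ c, 0 < c ∧ ∀ X₀ ∈ Gam Ω c₁ c₂, ∀ X ∈ Gam Ω c₁ c₂, ∀ Y₁ ∈ S, ∀ Y₂ ∈ S,
      ∀ l ∈ Icc (1 / 4 : ℝ) (3 / 4), ∀ e, 0 ≤ e →
      -e ≤ pathDefect (X - X₀) ((‖X₀‖ - ‖X‖) / κ) (dir (Y₁ - X₀)) ‖Y₁ - X₀‖⁻¹ →
      -e ≤ pathDefect (X - X₀) ((‖X₀‖ - ‖X‖) / κ) (dir (Y₂ - X₀)) ‖Y₂ - X₀‖⁻¹ →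
      c * ‖Y₁ - Y₂‖ ^ 2 * ‖dir X - dir X₀‖ ^ 2 - 2 * e ≤
        pathDefect (X - X₀) ((‖X₀‖ - ‖X‖) / κ) (dir (targetCurvePt κ s X₀ Y₁ Y₂ l - X₀))
          ‖targetCurvePt κ s X₀ Y₁ Y₂ l - X₀‖⁻¹ := by
  obtain ⟨k, hk, hβk⟩ := hA.exists_mul_norm_sub_sq_le_one_sub_betaCoef hκ0 hκ1 hc₁ hΩ
  obtain ⟨μ, hμ0, hμ1, hconc⟩ := hC
  have hκ2 : 0 < 1 - κ ^ 2 := sub_pos.2 (pow_lt_one₀ hκ0.le hκ1 two_ne_zero)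
  refine ⟨k * ((1 - κ ^ 2) * (c₁ / (2 * κ))) / 2, by positivity,
    fun X₀ hX₀ X hX Y₁ hY₁ Y₂ hY₂ l hl e he he₁ he₂ => ?_⟩
  have hl' : l ∈ Icc (0 : ℝ) 1 := Icc_subset_Icc (by norm_num) (by norm_num) hl
  obtain ⟨hx₀, hr₀⟩ := (mem_Gam_iff hΩ hc₁).1 hX₀
  obtain ⟨-, hr⟩ := (mem_Gam_iff hΩ hc₁).1 hX
  have hX₀0 : X₀ ≠ 0 := norm_pos_iff.1 (hc₁.trans_le hr₀.1)
  have hX0 : X ≠ 0 := norm_pos_iff.1 (hc₁.trans_le hr.1)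
  have hYl := hA.targetCurvePt_mem hX₀ hY₁ hY₂ hl'
  obtain ⟨-, hm₁, hs₁⟩ := hA.exists_polar hX₀ hY₁
  obtain ⟨-, hm₂, hs₂⟩ := hA.exists_polar hX₀ hY₂
  obtain ⟨-, -, hs⟩ := hA.exists_polar hX₀ hYl
  have hfar := hB.two_mul_div_le_norm_sub hκ0 hc₁ hΩ hA hX₀ hYl
  have hβ := betaCoef_mem_Icc hκ0 hκ1 (norm_eq_one_of_mem hΩ hx₀) (hA.norm_dir_sub hX₀ hY₁)
    (hA.norm_dir_sub hX₀ hY₂) hl'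
  have hβk := hβk X₀ hX₀ Y₁ hY₁ Y₂ hY₂ l hl
  have hconc := hconc X₀ hX₀ _ hm₁ _ hm₂ l hl'
  have hdir := hA.dir_targetCurvePt_sub hX₀ hY₁ hY₂ hl'
  rw [← hdir, hs₁, hs₂, hs, one_div, one_div, one_div] at hconc
  have hm := hA.norm_dir_sub hX₀ hYl
  rw [hdir, curvePt_eq] at hm ⊢
  set β := betaCoef κ (dir X₀) (dir (Y₁ - X₀)) (dir (Y₂ - X₀)) l
  set T := ‖X‖ * ‖dir X - dir X₀‖ ^ 2 / (2 * κ) with hT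
  have hgain : c₁ / (2 * κ) * ‖dir X - dir X₀‖ ^ 2 ≤ T := by
    rw [hT, div_mul_eq_mul_div]
    gcongr
    exact hr.1
  have hT0 : 0 ≤ T := by positivity
  have hdefect := le_pathDefect (ν := μ / ‖X₀‖) (D := c₂ / κ) (θ := (1 - κ ^ 2) * T)
    (mul_nonneg (sub_nonneg.2 hl'.2) hβ.1) (mul_nonneg hl'.1 hβ.1) (sub_nonneg.2 hβ.2) (by ring)
    (hA.norm_dir_sub hX₀ hY₁) hm (abs_norm_sub_norm_div_le hκ0 hc₁ hΩ hX₀ hX)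
    (inv_nonneg.2 (norm_nonneg _)) (inv_nonneg.2 (norm_nonneg _)) (inv_nonneg.2 (norm_nonneg _))
    (inv_mul_le_one_of_le₀ hfar (norm_nonneg _)) he he₁ he₂ (by positivity)
    ((mul_le_of_le_one_left hT0 (sub_le_self 1 (sq_nonneg κ))).trans
      (pathDefect_inv_smul_dir_zero hκ0.ne' hX0 hX₀0).ge)
    (mul_le_pathDefect_inv_smul_dir hκ0 hκ1 hμ0 hμ1.le hX0 hX₀0) hconc
  refine le_trans (sub_le_sub_right ?_ _) hdefect
  calc k * ((1 - κ ^ 2) * (c₁ / (2 * κ))) / 2 * ‖Y₁ - Y₂‖ ^ 2 * ‖dir X - dir X₀‖ ^ 2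
      = k * ‖Y₁ - Y₂‖ ^ 2 * ((1 - κ ^ 2) * (c₁ / (2 * κ) * ‖dir X - dir X₀‖ ^ 2)) / 2 := by ring
    _ ≤ (1 - β) * ((1 - κ ^ 2) * T) / 2 := by gcongr; exact sub_nonneg.2 hβ.2

-- Both endpoints are allowed to fail minimality by `e`, which is what the comparison of two
-- nearby contact points needs.
theorem exists_opticalPath_gain (hκ0 : 0 < κ) (hκ1 : κ < 1) (hc₁ : 0 < c₁) (hc₂ : 0 < c₂)
    (hΩ : Ω ⊆ unitSphere n) (hA : HypA κ c₁ c₂ Ω S E s) (hB : HypB κ c₁ c₂ Ω S)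
    (hC : HypC κ c₁ c₂ Ω E s) :
    ∃ c C : ℝ, 0 < c ∧ 0 < C ∧ ∀ X₀ ∈ Gam Ω c₁ c₂, ∀ X ∈ Gam Ω c₁ c₂, ∀ Y₁ ∈ S, ∀ Y₂ ∈ S,
      ∀ l ∈ Icc (1 / 4 : ℝ) (3 / 4), ∀ e, 0 ≤ e →
      opticalPath κ X₀ Y₁ - e ≤ opticalPath κ X Y₁ →
      opticalPath κ X₀ Y₂ - e ≤ opticalPath κ X Y₂ →
      opticalPath κ X₀ (targetCurvePt κ s X₀ Y₁ Y₂ l) +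
          c * ‖Y₁ - Y₂‖ ^ 2 * ‖dir X - dir X₀‖ ^ 2 - C * e ≤
        opticalPath κ X (targetCurvePt κ s X₀ Y₁ Y₂ l) := by
  obtain ⟨k, hk, hgain⟩ := exists_pathDefect_gain hκ0 hκ1 hc₁ hΩ hA hB hC
  obtain ⟨a, b, ha, hb, hF⟩ := exists_opticalPath_sub_eq_mul_pathDefect hκ0 hc₁ hc₂ hΩ hA hB
  refine ⟨a * k, b * (2 / a), by positivity, by positivity,
    fun X₀ hX₀ X hX Y₁ hY₁ Y₂ hY₂ l hl e he he₁ he₂ => ?_⟩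
  have hdefect {Y : Rn n} (hY : Y ∈ S) (h : opticalPath κ X₀ Y - e ≤ opticalPath κ X Y) :
      -(e / a) ≤ pathDefect (X - X₀) ((‖X₀‖ - ‖X‖) / κ) (dir (Y - X₀)) ‖Y - X₀‖⁻¹ := by
    obtain ⟨F, ⟨haF, -⟩, hFeq⟩ := hF X₀ hX₀ X hX Y hY
    have hF0 : 0 < F := ha.trans_le haF
    refine (neg_le_neg (div_le_div_of_nonneg_left he ha haF)).trans ?_
    rw [neg_le, le_div_iff₀ hF0]
    linarith
  have hl' : l ∈ Icc (0 : ℝ) 1 := Icc_subset_Icc (by norm_num) (by norm_num) hl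
  obtain ⟨F, ⟨haF, hFb⟩, hFeq⟩ := hF X₀ hX₀ X hX _ (hA.targetCurvePt_mem hX₀ hY₁ hY₂ hl')
  have hpd := hgain X₀ hX₀ X hX Y₁ hY₁ Y₂ hY₂ l hl (e / a) (by positivity) (hdefect hY₁ he₁)
    (hdefect hY₂ he₂)
  have hF0 : 0 ≤ F := ha.le.trans haF
  have hlow : a * (k * ‖Y₁ - Y₂‖ ^ 2 * ‖dir X - dir X₀‖ ^ 2) - b * (2 * (e / a)) ≤
      F * (k * ‖Y₁ - Y₂‖ ^ 2 * ‖dir X - dir X₀‖ ^ 2) - F * (2 * (e / a)) := by gcongr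
  have hscaled := mul_le_mul_of_nonneg_left hpd hF0
  have hCe : b * (2 * (e / a)) = b * (2 / a) * e := by ring
  linarith

end

/-! ### Hausdorff measure of spherical caps -/

section

section Cap

open scoped NNReal

lemma hausdorffMeasure_le_mul_image {X Y : Type*} [MetricSpace X] [MeasurableSpace X]
    [BorelSpace X] [MetricSpace Y] [MeasurableSpace Y] [BorelSpace Y] {f : X → Y} {A : Set X}
    {K : ℝ≥0} {d : ℝ} (hd : 0 ≤ d) (hf : ∀ x ∈ A, ∀ y ∈ A, dist x y ≤ K * dist (f x) (f y)) :
    μH[d] A ≤ (K : ℝ≥0∞) ^ d * μH[d] (f '' A) := by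
  have h : AntilipschitzWith K (A.domRestrict f) :=
    AntilipschitzWith.of_le_mul_dist fun x y => hf x x.2 y y.2
  have hA := h.le_hausdorffMeasure_image hd univ
  rwa [← isometry_subtype_coe.hausdorffMeasure_image (.inl hd), image_univ, image_univ,
    Subtype.range_coe, range_domRestrict] at hA

/-- The difference of the components of `m` and `m'` along `x` is controlled by the orthogonal
components because the vectors stay away from the equator `⟨m, x⟩ = 0`. -/
lemma norm_sub_le_mul_of_norm_sq_eq {V W : Type*} [NormedAddCommGroup V] [InnerProductSpace ℝ V]
    [NormedAddCommGroup W] [NormedSpace ℝ W] {π : V →L[ℝ] W} {x m m' : V}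
    (hπ : ∀ v, ‖π v‖ ^ 2 = ‖v‖ ^ 2 - inner ℝ v x ^ 2) (hm : ‖m‖ = 1) (hm' : ‖m'‖ = 1) {a : ℝ}
    (ha : 0 < a) (hma : a ≤ inner ℝ m x) (hma' : a ≤ inner ℝ m' x) :
    ‖m - m'‖ ≤ 2 / a * ‖π m - π m'‖ := by
  have h := hπ m
  have h' := hπ m'
  have hdiff := hπ (m - m')
  rw [hm] at h
  rw [hm'] at h'
  rw [map_sub, inner_sub_left] at hdiff
  set t : ℝ := inner ℝ m x
  set t' : ℝ := inner ℝ m' x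
  set D := ‖π m - π m'‖
  have hle : ‖π m‖ ≤ 1 := by nlinarith [norm_nonneg (π m)]
  have hle' : ‖π m'‖ ≤ 1 := by nlinarith [norm_nonneg (π m')]
  have ha1 : a ≤ 1 := by nlinarith [sq_nonneg ‖π m‖]
  have haxis : a * |t - t'| ≤ D := by
    have hprod : |t - t'| * (t + t') = |‖π m‖ - ‖π m'‖| * (‖π m‖ + ‖π m'‖) := by
      rw [← abs_of_nonneg (by linarith : 0 ≤ t + t'), ← abs_mul, abs_sub_comm ‖π m‖,
        ← abs_of_nonneg (by positivity : 0 ≤ ‖π m‖ + ‖π m'‖), ← abs_mul]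
      exact congrArg abs (by linear_combination h - h')
    have hlower : |t - t'| * (2 * a) ≤ |t - t'| * (t + t') := by gcongr; linarith
    have hupper : |‖π m‖ - ‖π m'‖| * (‖π m‖ + ‖π m'‖) ≤ D * 2 := by
      gcongr
      · exact abs_norm_sub_norm_le _ _
      · linarith
    linarith
  have hsq : ‖m - m'‖ ^ 2 = D ^ 2 + |t - t'| ^ 2 := by rw [sq_abs]; linarith
  have hbound : (a * ‖m - m'‖) ^ 2 ≤ (2 * D) ^ 2 := by
    have h1 : (a * |t - t'|) ^ 2 ≤ D ^ 2 := by gcongr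
    have h2 : (a * D) ^ 2 ≤ (1 * D) ^ 2 := by gcongr
    rw [mul_pow, hsq]
    nlinarith [sq_nonneg D]
  rw [div_mul_eq_mul_div, le_div_iff₀ ha, mul_comm]
  exact le_of_sq_le_sq hbound (by positivity)

variable {n : ℕ}

lemma exists_norm_sq_eq_norm_sq_sub_inner_sq (hn : 1 ≤ n) {x : Rn n} (hx : ‖x‖ = 1) :
    ∃ π : Rn n →L[ℝ] Rn (n - 1), ∀ v, ‖π v‖ ^ 2 = ‖v‖ ^ 2 - inner ℝ v x ^ 2 := by
  have : Fact (Module.finrank ℝ (Rn n) = n - 1 + 1) := ⟨by simp; omega⟩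
  have hx0 : x ≠ 0 := norm_ne_zero_iff.1 (hx ▸ one_ne_zero)
  let b := OrthonormalBasis.fromOrthogonalSpanSingleton (𝕜 := ℝ) (n - 1) hx0
  refine ⟨b.repr.toContinuousLinearEquiv.toContinuousLinearMap ∘L
    (ℝ ∙ x)ᗮ.orthogonalProjectionOnto, fun v => ?_⟩
  have hsplit := Submodule.norm_sq_eq_add_norm_sq_starProjection v (ℝ ∙ x)
  rw [Submodule.starProjection_unit_singleton ℝ hx, norm_smul, hx, mul_one, Real.norm_eq_abs,
    sq_abs, real_inner_comm] at hsplit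
  have hπ : ‖b.repr ((ℝ ∙ x)ᗮ.orthogonalProjectionOnto v)‖ = ‖(ℝ ∙ x)ᗮ.starProjection v‖ :=
    b.repr.norm_map _
  change ‖b.repr ((ℝ ∙ x)ᗮ.orthogonalProjectionOnto v)‖ ^ 2 = _
  rw [hπ]
  linarith

lemma natCast_sub_one_eq_finrank (hn : 1 ≤ n) : (n : ℝ) - 1 = Module.finrank ℝ (Rn (n - 1)) := by
  rw [finrank_euclideanSpace_fin, Nat.cast_sub hn, Nat.cast_one]

lemma exists_hausdorffMeasure_closedBall_eq (hn : 1 ≤ n) : ∃ V : ℝ≥0, ∀ (p : Rn (n - 1)) (r : ℝ),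
    0 ≤ r → μH[(n : ℝ) - 1] (Metric.closedBall p r) = V * ENNReal.ofReal (r ^ (n - 1)) := by
  rw [natCast_sub_one_eq_finrank hn]
  refine ⟨(μH[Module.finrank ℝ (Rn (n - 1))] (Metric.ball (0 : Rn (n - 1)) 1)).toNNReal,
    fun p r hr => ?_⟩
  rw [Measure.addHaar_closedBall _ _ hr, ENNReal.coe_toNNReal measure_ball_lt_top.ne,
    finrank_euclideanSpace_fin, mul_comm]

lemma exists_hausdorff_small_cap_le (hn : 1 ≤ n) : ∃ C : ℝ≥0, ∀ (c : Rn n) (σ : ℝ), 0 < σ →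
    σ ≤ 1 / 4 →
      hausdorff n (Metric.ball c σ ∩ unitSphere n) ≤ C * ENNReal.ofReal (σ ^ (n - 1)) := by
  obtain ⟨V, hV⟩ := exists_hausdorffMeasure_closedBall_eq hn
  have hd : 0 ≤ (n : ℝ) - 1 := sub_nonneg.2 (mod_cast hn)
  refine ⟨4 ^ ((n : ℝ) - 1) * (V * (2 : ℝ≥0) ^ (n - 1)), fun c σ hσ hσ4 => ?_⟩
  rcases (Metric.ball c σ ∩ unitSphere n).eq_empty_or_nonempty with h | ⟨x, hxσ, hx⟩
  · simp [h]
  have hx1 : ‖x‖ = 1 := mem_sphere_zero_iff_norm.1 hx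
  obtain ⟨π, hπ⟩ := exists_norm_sq_eq_norm_sq_sub_inner_sq hn hx1
  have hdist : ∀ m ∈ Metric.ball c σ ∩ unitSphere n, ‖m - x‖ ≤ 2 * σ := fun m hm => by
    have := dist_triangle_right m x c
    rw [dist_eq_norm] at this
    linarith [Metric.mem_ball.1 hm.1, Metric.mem_ball.1 hxσ]
  have hcap : ∀ m ∈ Metric.ball c σ ∩ unitSphere n, 1 / 2 ≤ inner ℝ m x := fun m hm => by
    have h := norm_sub_sq_real m x
    rw [mem_sphere_zero_iff_norm.1 hm.2, hx1] at h
    nlinarith [hdist m hm, norm_nonneg (m - x)]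
  have himage : π '' (Metric.ball c σ ∩ unitSphere n) ⊆ Metric.closedBall (π x) (2 * σ) := by
    rintro _ ⟨m, hm, rfl⟩
    rw [Metric.mem_closedBall, dist_eq_norm, ← map_sub]
    refine le_trans ?_ (hdist m hm)
    refine le_of_sq_le_sq ((hπ _).trans_le ?_) (norm_nonneg _)
    exact sub_le_self _ (sq_nonneg _)
  have hle := hausdorffMeasure_le_mul_image (f := π) (K := 4) hd fun m hm m' hm' => by
    simpa only [dist_eq_norm, NNReal.coe_ofNat, (by norm_num : (2 : ℝ) / (1 / 2) = 4)] using
      norm_sub_le_mul_of_norm_sq_eq hπ (mem_sphere_zero_iff_norm.1 hm.2)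
        (mem_sphere_zero_iff_norm.1 hm'.2) one_half_pos (hcap m hm) (hcap m' hm')
  refine hle.trans ((mul_le_mul_right (measure_mono himage) _).trans_eq ?_)
  rw [hV _ _ (by positivity), mul_pow, ENNReal.ofReal_mul (by positivity), ENNReal.coe_mul,
    ENNReal.coe_mul, ENNReal.coe_rpow_of_nonneg _ hd, ENNReal.ofReal_pow zero_le_two,
    ENNReal.ofReal_ofNat]
  push_cast
  ring

lemma exists_hausdorff_cap_le (hn : 1 ≤ n) : ∃ C : ℝ≥0, ∀ (c : Rn n) (σ : ℝ), 0 < σ →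
    hausdorff n (Metric.ball c σ ∩ unitSphere n) ≤ C * ENNReal.ofReal (σ ^ (n - 1)) := by
  obtain ⟨C, hC⟩ := exists_hausdorff_small_cap_le hn
  have hfin : hausdorff n (unitSphere n) ≠ ∞ := by
    refine ((isCompact_sphere 0 1).measure_lt_top_of_nhdsWithin fun x _ => ?_).ne
    refine ⟨Metric.ball x (1 / 4) ∩ unitSphere n, ?_, ?_⟩
    · exact Filter.inter_mem (mem_nhdsWithin_of_mem_nhds (Metric.ball_mem_nhds x (by norm_num)))
        self_mem_nhdsWithin
    · exact (hC x (1 / 4) (by norm_num) le_rfl).trans_lt (by finiteness)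
  lift hausdorff n (unitSphere n) to ℝ≥0 using hfin with M hM
  refine ⟨C + M * 4 ^ (n - 1), fun c σ hσ => ?_⟩
  push_cast
  rw [add_mul]
  rcases le_or_gt σ (1 / 4) with hσ4 | hσ4
  · exact (hC c σ hσ hσ4).trans le_self_add
  · calc hausdorff n (Metric.ball c σ ∩ unitSphere n) ≤ M * 1 := by
          rw [mul_one, hM]; exact measure_mono inter_subset_right
      _ ≤ M * (4 ^ (n - 1) * ENNReal.ofReal (σ ^ (n - 1))) := by
          gcongr
          rw [ENNReal.ofReal_pow hσ.le, ← mul_pow]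
          refine one_le_pow₀ ?_
          rw [← ENNReal.ofReal_ofNat 4, ← ENNReal.ofReal_mul (by norm_num), ENNReal.one_le_ofReal]
          linarith
      _ ≤ _ := by rw [mul_assoc]; exact le_add_self

end Cap

end

/-! ### Points of the target that support the refractor twice -/

section

section TangentCone

open Filter Topology

variable {V W Z : Type*} [NormedAddCommGroup V] [NormedSpace ℝ V] [NormedAddCommGroup W]
  [NormedSpace ℝ W] [NormedAddCommGroup Z] [NormedSpace ℝ Z]

lemma posTangentConeAt_subset_tangentConeAt (Q : Set V) (p : V) :
    posTangentConeAt Q p ⊆ tangentConeAt ℝ Q p :=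
  tangentConeAt_mono_field

lemma ae_posTangentConeAt_eq_univ [FiniteDimensional ℝ V] [MeasurableSpace V] [BorelSpace V]
    (μ : Measure V) [μ.IsAddHaarMeasure] (Q : Set V) :
    ∀ᵐ p ∂μ, p ∈ Q → posTangentConeAt Q p = univ := by
  filter_upwards [ae_imp_of_ae_restrict (Besicovitch.ae_tendsto_measure_inter_div μ Q)]
    with p hdensity hp
  refine eq_univ_of_forall fun v => ?_
  have hmeet : ∃ᶠ q in 𝓝[>] (0 : ℝ) ×ˢ 𝓝 v, p + q.1 • q.2 ∈ Q := by
    intro hempty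
    obtain ⟨P, hP, P', hP', hPP'⟩ := eventually_prod_iff.1 hempty
    obtain ⟨ε, hε, hball⟩ := Metric.nhds_basis_closedBall.eventually_iff.1 hP'
    obtain ⟨t, ht, htP⟩ := ((Measure.eventually_nonempty_inter_smul_of_density_one μ Q p
      (hdensity hp) (Metric.closedBall v ε) measurableSet_closedBall
      (Metric.measure_closedBall_pos μ v hε).ne').and hP).exists
    obtain ⟨_, hQ, hmem⟩ := ht
    rw [singleton_add] at hmem
    obtain ⟨_, ⟨w, hw, rfl⟩, rfl⟩ := hmem
    exact hPP' htP (hball hw) hQ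
  have hpos : ∀ᶠ q : ℝ × V in 𝓝[>] (0 : ℝ) ×ˢ 𝓝 v, 0 < q.1 :=
    tendsto_fst.eventually self_mem_nhdsWithin
  refine mem_tangentConeAt_of_frequently _ (fun q : ℝ × V => q.1⁻¹.toNNReal)
    (fun q => q.1 • q.2) ?_ hmeet ?_
  · have h : Tendsto (fun q : ℝ × V => q.1 • q.2) (𝓝 0 ×ˢ 𝓝 v) (𝓝 ((0 : ℝ) • v)) := by
      rw [← nhds_prod_eq]; exact (continuous_fst.smul continuous_snd).tendsto _
    rw [zero_smul] at h
    exact h.mono_left (prod_mono_left _ nhdsWithin_le_nhds)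
  · refine tendsto_snd.congr' ?_
    filter_upwards [hpos] with q hq
    rw [NNReal.smul_def, Real.coe_toNNReal _ (inv_nonneg.2 hq.le), smul_smul,
      inv_mul_cancel₀ hq.ne', one_smul]

lemma norm_apply_le_of_mem_tangentConeAt {Q : Set V} {p v : V} (hv : v ∈ tangentConeAt ℝ Q p)
    {f : V → W} {g : V → Z} {f' : V →L[ℝ] W} {g' : V →L[ℝ] Z} (hf : HasFDerivWithinAt f f' Q p)
    (hg : HasFDerivWithinAt g g' Q p) {C : ℝ}
    (hfg : ∀ q ∈ Q, ‖f q - f p‖ ≤ C * ‖g q - g p‖) : ‖f' v‖ ≤ C * ‖g' v‖ := by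
  obtain ⟨ι, l, hl, c, d, hd, hdQ, hcd⟩ := exists_fun_of_mem_tangentConeAt hv
  refine le_of_tendsto_of_tendsto (hf.lim hd hdQ hcd).norm
    ((hg.lim hd hdQ hcd).norm.const_mul C) ?_
  filter_upwards [hdQ] with k hk
  rw [norm_smul, norm_smul, mul_left_comm]
  exact mul_le_mul_of_nonneg_left (hfg _ hk) (norm_nonneg _)

lemma hasFDerivWithinAt_eq_of_le {Q : Set V} {p : V} (hQ : posTangentConeAt Q p = univ)
    {f g : V → ℝ} {f' g' : V →L[ℝ] ℝ}
    (hf : HasFDerivWithinAt f f' Q p) (hg : HasFDerivWithinAt g g' Q p)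
    (hfg : ∀ q ∈ Q, f q ≤ g q) (hfgp : f p = g p) : f' = g' := by
  ext v
  have hmin : IsMinOn (g - f) Q p := fun q hq => by
    simpa [hfgp] using hfg q hq
  have h := hmin.localize.hasFDerivWithinAt_eq_zero (hg.sub hf) (y := v) (by simp [hQ])
    (by simp [hQ])
  exact (sub_eq_zero.1 h).symm

end TangentCone

variable {n : ℕ} {κ c₁ c₂ : ℝ} {Ω S : Set (Rn n)} {E : Rn n → Set (Rn n)}
  {s : Rn n → Rn n → ℝ} {u : Rn n → ℝ}

lemma hasFDerivAt_norm {v : Rn n} (hv : v ≠ 0) :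
    HasFDerivAt (fun w : Rn n => ‖w‖) (innerSL ℝ (dir v)) v := by
  have hv' : ‖v‖ ^ 2 ≠ 0 := pow_ne_zero 2 (norm_ne_zero_iff.2 hv)
  have h := (hasStrictFDerivAt_norm_sq v).hasFDerivAt.sqrt hv'
  simp only [Real.sqrt_sq (norm_nonneg _)] at h
  refine h.congr_fderiv ?_
  ext w
  simp only [smul_apply, innerSL_apply_apply, dir, real_inner_smul_left, smul_eq_mul,
    nsmul_eq_mul]
  field_simp
  norm_num

lemma hasFDerivAt_dir {v : Rn n} (hv : v ≠ 0) :
    HasFDerivAt (dir : Rn n → Rn n)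
      (‖v‖⁻¹ • (ContinuousLinearMap.id ℝ (Rn n) - (innerSL ℝ (dir v)).smulRight (dir v))) v := by
  have hv' : ‖v‖ ≠ 0 := norm_ne_zero_iff.2 hv
  have h := ((hasDerivAt_inv hv').comp_hasFDerivAt v (hasFDerivAt_norm hv)).smul (hasFDerivAt_id v)
  refine h.congr_fderiv (ContinuousLinearMap.ext fun w => ?_)
  simp only [smul_apply, sub_apply, ContinuousLinearMap.id_apply,
    ContinuousLinearMap.smulRight_apply, innerSL_apply_apply, add_apply, Function.comp_apply,
    id_eq, dir, real_inner_smul_left, smul_eq_mul]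
  match_scalars <;> field_simp

lemma hasFDerivAt_opticalPath (κ : ℝ) {X Y : Rn n} (hXY : Y ≠ X) :
    HasFDerivAt (opticalPath κ X) (κ • innerSL ℝ (dir (Y - X))) Y := by
  have h := (hasFDerivAt_norm (sub_ne_zero.2 hXY)).comp Y ((hasFDerivAt_id Y).sub_const X)
  have h' := (h.const_mul κ).const_add ‖X‖
  rw [ContinuousLinearMap.comp_id] at h'
  refine h'.congr_of_eventuallyEq (Filter.Eventually.of_forall fun Z => ?_)
  simp [opticalPath, norm_sub_rev]

/-- When `X₂` moves towards `Y` at unit speed, `‖X₂‖` grows faster than `κ`, the rate at which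
`κ * ‖X₂ - Y‖` decreases. -/
lemma eq_of_dir_sub_eq_of_opticalPath_eq (hκ0 : 0 < κ) (hκ1 : κ < 1) {X₁ X₂ Y : Rn n}
    (h₁ : κ ≤ inner ℝ (dir X₁) (dir (Y - X₁))) (h₂ : κ ≤ inner ℝ (dir X₂) (dir (Y - X₂)))
    (hdir : dir (Y - X₁) = dir (Y - X₂)) (hpath : opticalPath κ X₁ Y = opticalPath κ X₂ Y) :
    X₁ = X₂ := by
  wlog hle : ‖Y - X₁‖ ≤ ‖Y - X₂‖ generalizing X₁ X₂
  · exact (this h₂ h₁ hdir.symm hpath.symm (le_of_not_ge hle)).symm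
  have hX₂ : X₂ ≠ 0 := by rintro rfl; simp [dir] at h₂; linarith
  have hYX₂ : Y - X₂ ≠ 0 := by intro h; simp [h, dir] at h₂; linarith
  set e := dir (Y - X₂) with he
  set t := ‖Y - X₂‖ - ‖Y - X₁‖ with ht
  have ht0 : 0 ≤ t := sub_nonneg.2 hle
  have hX₁ : X₁ = X₂ + t • e := by
    have h₁' := norm_smul_dir (Y - X₁)
    have h₂' := norm_smul_dir (Y - X₂)
    rw [hdir] at h₁'
    rw [ht, sub_smul, h₁', h₂']
    abel
  have hnorm : ‖X₁‖ = ‖X₂‖ + κ * t := by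
    simp only [opticalPath, norm_sub_rev _ Y] at hpath
    linarith
  have hsq : ‖X₁‖ ^ 2 = ‖X₂‖ ^ 2 + 2 * (t * inner ℝ X₂ e) + t ^ 2 := by
    rw [hX₁, norm_add_sq_real, real_inner_smul_right, norm_smul, norm_dir hYX₂, mul_one,
      Real.norm_eq_abs, sq_abs]
  have hinner : κ * ‖X₂‖ ≤ inner ℝ X₂ e := by
    rwa [dir, real_inner_smul_left, ← div_eq_inv_mul, le_div_iff₀ (norm_pos_iff.2 hX₂)] at h₂
  have hts : t ^ 2 ≤ κ ^ 2 * t ^ 2 := by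
    rw [hnorm] at hsq
    nlinarith [mul_le_mul_of_nonneg_left hinner ht0]
  have ht : t = 0 := by
    by_contra h
    have hpos := mul_pos (sq_pos_of_ne_zero h) (by nlinarith : 0 < 1 - κ ^ 2)
    linarith
  rw [hX₁, ht, zero_smul, add_zero]

lemma isPreconnected_Gam (hΩ : IsPreconnected Ω) : IsPreconnected (Gam Ω c₁ c₂) := by
  have h : Gam Ω c₁ c₂ = (fun p : ℝ × Rn n => p.1 • p.2) '' (Icc c₁ c₂ ×ˢ Ω) := by
    ext X
    simp only [Gam, mem_ofPred_eq, mem_image, mem_prod, mem_Icc, Prod.exists]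
    constructor
    · rintro ⟨x, hx, r, hr₁, hr₂, rfl⟩
      exact ⟨r, x, ⟨⟨hr₁, hr₂⟩, hx⟩, rfl⟩
    · rintro ⟨r, x, ⟨⟨hr₁, hr₂⟩, hx⟩, rfl⟩
      exact ⟨x, hx, r, hr₁, hr₂, rfl⟩
  rw [h]
  exact (isPreconnected_Icc.prod hΩ).image _ (by fun_prop)

/-- Otherwise `T` would be the hyperplane orthogonal to the difference `z` of the two directions,
and `⟪z, Y - X⟫` would vanish somewhere on the way from `X₁` to `X₂`. -/
lemma dir_sub_eq_of_inner_eq {G : Set (Rn n)} (hG : IsPreconnected G) {Y : Rn n}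
    {T : Submodule ℝ (Rn n)} (hT : n ≤ Module.finrank ℝ T + 1) (hTdir : ∀ X ∈ G, dir (Y - X) ∉ T)
    {X₁ X₂ : Rn n} (hX₁ : X₁ ∈ G) (hX₂ : X₂ ∈ G)
    (heq : ∀ v ∈ T, inner ℝ (dir (Y - X₁)) v = inner ℝ (dir (Y - X₂)) v) :
    dir (Y - X₁) = dir (Y - X₂) := by
  have hunit {X : Rn n} (hX : X ∈ G) : ‖dir (Y - X)‖ = 1 := by
    refine norm_dir fun h => hTdir X hX ?_
    simp [h, dir]
  by_contra hne
  set z := dir (Y - X₁) - dir (Y - X₂) with hz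
  have hle : T ≤ (ℝ ∙ z)ᗮ := fun v hv => by
    rw [Submodule.mem_orthogonal_singleton_iff_inner_right, hz, inner_sub_left, heq v hv, sub_self]
  have hfinrank : Module.finrank ℝ (ℝ ∙ z)ᗮ + 1 = n := by
    have h := (ℝ ∙ z).finrank_add_finrank_orthogonal
    rw [finrank_span_singleton (sub_ne_zero.2 hne), finrank_euclideanSpace_fin] at h
    omega
  have hTz : T = (ℝ ∙ z)ᗮ := Submodule.eq_of_le_of_finrank_le hle (by omega)
  have hcs : inner ℝ (dir (Y - X₁)) (dir (Y - X₂)) ≤ (1 : ℝ) := by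
    simpa only [hunit hX₁, hunit hX₂, mul_one] using
      real_inner_le_norm (dir (Y - X₁)) (dir (Y - X₂))
  have hpos : 0 ≤ inner ℝ z (Y - X₁) := by
    rw [← norm_smul_dir (Y - X₁), real_inner_smul_right, hz, inner_sub_left,
      real_inner_self_eq_norm_sq, hunit hX₁, real_inner_comm]
    exact mul_nonneg (norm_nonneg _) (by linarith)
  have hneg : inner ℝ z (Y - X₂) ≤ 0 := by
    rw [← norm_smul_dir (Y - X₂), real_inner_smul_right, hz, inner_sub_left,
      real_inner_self_eq_norm_sq, hunit hX₂]
    exact mul_nonpos_of_nonneg_of_nonpos (norm_nonneg _) (by linarith)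
  obtain ⟨X, hX, hzero⟩ := hG.intermediate_value hX₂ hX₁
    (f := fun X => (inner ℝ z (Y - X) : ℝ)) (by fun_prop) ⟨hneg, hpos⟩
  refine hTdir X hX ?_
  rw [hTz, Submodule.mem_orthogonal_singleton_iff_inner_right, dir, real_inner_smul_right]
  exact mul_eq_zero_of_right _ hzero

section Support

variable {P : Type*} [NormedAddCommGroup P] [NormedSpace ℝ P] {Q : Set P} {p : P} {Φ : P → Rn n}
  {L : P →L[ℝ] Rn n} {f : P → ℝ} {f' : P →L[ℝ] ℝ} {X : Rn n}

lemma fderiv_eq_inner_dir_of_le_opticalPath (hQ : posTangentConeAt Q p = univ)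
    (hΦ : HasFDerivWithinAt Φ L Q p) (hf : HasFDerivWithinAt f f' Q p) (hX : Φ p ≠ X)
    (hle : ∀ q ∈ Q, f q ≤ opticalPath κ X (Φ q)) (heq : f p = opticalPath κ X (Φ p)) :
    f' = (κ • innerSL ℝ (dir (Φ p - X))).comp L :=
  hasFDerivWithinAt_eq_of_le hQ hf
    ((hasFDerivAt_opticalPath κ hX).comp_hasFDerivWithinAt p hΦ) hle heq

lemma apply_ne_dir_of_norm_sub_le_mul_dir_sub {v : P} (hv : v ∈ tangentConeAt ℝ Q p)
    (hΦ : HasFDerivWithinAt Φ L Q p) (hX : Φ p ≠ X) {K : ℝ}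
    (hK : ∀ q ∈ Q, ‖Φ q - Φ p‖ ≤ K * ‖dir (Φ q - X) - dir (Φ p - X)‖) :
    L v ≠ dir (Φ p - X) := by
  intro hLv
  have hX' : Φ p - X ≠ 0 := sub_ne_zero.2 hX
  have hdir := (hasFDerivAt_dir hX').comp_hasFDerivWithinAt p (hΦ.sub_const X)
  have hle := norm_apply_le_of_mem_tangentConeAt hv hΦ hdir hK
  rw [ContinuousLinearMap.comp_apply, hLv] at hle
  simp [norm_dir hX'] at hle
  linarith

/-- The derivative of `f` determines the component of `dir (Φ p - X)` along the tangent space of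
`Φ` at `p`, which is a hyperplane transversal to all rays into `Φ p`. -/
lemma eq_of_le_opticalPath_of_hasFDerivWithinAt [FiniteDimensional ℝ P]
    (hP : n ≤ Module.finrank ℝ P + 1) (hκ0 : 0 < κ) (hκ1 : κ < 1) (hc₁ : 0 < c₁)
    (hΩ : Ω ⊆ unitSphere n) (hΩconn : IsPreconnected Ω) (hA : HypA κ c₁ c₂ Ω S E s) (hp : p ∈ Q)
    (hQ : posTangentConeAt Q p = univ) (hΦS : MapsTo Φ Q S) (hΦ : HasFDerivWithinAt Φ L Q p)
    (hf : HasFDerivWithinAt f f' Q p) {C : ℝ} (hC : ∀ q ∈ Q, ‖q - p‖ ≤ C * ‖Φ q - Φ p‖)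
    {X₁ X₂ : Rn n} (hX₁ : X₁ ∈ Gam Ω c₁ c₂) (hX₂ : X₂ ∈ Gam Ω c₁ c₂)
    (hle₁ : ∀ q ∈ Q, f q ≤ opticalPath κ X₁ (Φ q)) (heq₁ : f p = opticalPath κ X₁ (Φ p))
    (hle₂ : ∀ q ∈ Q, f q ≤ opticalPath κ X₂ (Φ q)) (heq₂ : f p = opticalPath κ X₂ (Φ p)) :
    X₁ = X₂ := by
  have hY : Φ p ∈ S := hΦS hp
  have htangent (v : P) : v ∈ tangentConeAt ℝ Q p :=
    posTangentConeAt_subset_tangentConeAt Q p (hQ ▸ mem_univ v)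
  obtain ⟨K, -, hK⟩ := hA.exists_norm_sub_le_mul_dir_sub hΩ hc₁
  have hinj : Function.Injective L := by
    refine (injective_iff_map_eq_zero L).2 fun v hv => ?_
    have h := norm_apply_le_of_mem_tangentConeAt (htangent v) (hasFDerivWithinAt_id p Q) hΦ hC
    simpa [hv] using h
  have hgrad := (fderiv_eq_inner_dir_of_le_opticalPath hQ hΦ hf (hA.ne hX₁ hY) hle₁ heq₁).symm.trans
    (fderiv_eq_inner_dir_of_le_opticalPath hQ hΦ hf (hA.ne hX₂ hY) hle₂ heq₂)
  have hdir : dir (Φ p - X₁) = dir (Φ p - X₂) := by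
    refine dir_sub_eq_of_inner_eq (isPreconnected_Gam hΩconn) (T := L.range) ?_ ?_ hX₁ hX₂ ?_
    · rwa [LinearMap.finrank_range_of_inj hinj]
    · rintro X hX ⟨v, hv⟩
      exact apply_ne_dir_of_norm_sub_le_mul_dir_sub (htangent v) hΦ (hA.ne hX hY)
        (fun q hq => hK X hX _ (hΦS hq) _ hY) hv
    · rintro _ ⟨v, rfl⟩
      exact mul_left_cancel₀ hκ0.ne' (DFunLike.congr_fun hgrad v)
  exact eq_of_dir_sub_eq_of_opticalPath_eq hκ0 hκ1 (hA.refracts X₁ hX₁ _ hY)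
    (hA.refracts X₂ hX₂ _ hY) hdir (heq₁.symm.trans heq₂)

end Support

section DualPotential

variable {V : Type*} [NormedAddCommGroup V] {G : Set V}

/-- The dual potential of a set `G` of refraction points: `dualPotential κ G Y` is the largest `b`
for which `G` lies outside the oval with focus `Y` and optical length `b`. -/
def dualPotential (κ : ℝ) (G : Set V) (Y : V) : ℝ := ⨅ X : G, opticalPath κ (X : V) Y

lemma dualPotential_le (hκ : 0 ≤ κ) {X : V} (hX : X ∈ G) (Y : V) :
    dualPotential κ G Y ≤ opticalPath κ X Y := by
  refine ciInf_le ⟨0, ?_⟩ (⟨X, hX⟩ : G)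
  rintro _ ⟨X, rfl⟩
  unfold opticalPath
  positivity

lemma lipschitzWith_dualPotential (hκ : 0 ≤ κ) (G : Set V) :
    LipschitzWith κ.toNNReal (dualPotential κ G) := by
  refine LipschitzWith.of_le_add_mul _ fun Y Z => ?_
  rw [Real.coe_toNNReal _ hκ, dist_eq_norm]
  rcases isEmpty_or_nonempty G with hG | hG
  · simp only [dualPotential, Real.iInf_of_isEmpty]
    positivity
  · rw [← sub_le_iff_le_add]
    refine le_ciInf fun X => ?_
    linarith [dualPotential_le hκ X.2 Y, opticalPath_sub_le hκ X.1 Y Z]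

end DualPotential

lemma dualPotential_eq_of_mem_subdiff (hκ0 : 0 < κ) (hκ1 : κ < 1) (hc₁ : 0 < c₁)
    (hΩ : Ω ⊆ unitSphere n) (hu : ∀ x ∈ Ω, u x ∈ Icc c₁ c₂) {x Y : Rn n} (hx : x ∈ Ω)
    (hY : Y ∈ subdiff κ Ω S u x) :
    dualPotential κ ((fun x => u x • x) '' Ω) Y = opticalPath κ (u x • x) Y := by
  have : Nonempty ((fun x => u x • x) '' Ω) := ⟨_, mem_image_of_mem _ hx⟩
  refine le_antisymm (dualPotential_le hκ0.le (mem_image_of_mem _ hx) Y) (le_ciInf ?_)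
  rintro ⟨_, z, hz, rfl⟩
  exact ((mem_subdiff_iff hκ0 hκ1 hc₁ hΩ hu).1 hY).2 z hz

/-- The points of the target that support the refractor at two different points. -/
def multiSupport (κ : ℝ) (Ω S : Set (Rn n)) (u : Rn n → ℝ) : Set (Rn n) :=
  {Y | ∃ x₁ ∈ Ω, ∃ x₂ ∈ Ω, x₁ ≠ x₂ ∧ Y ∈ subdiff κ Ω S u x₁ ∧ Y ∈ subdiff κ Ω S u x₂}

lemma multiSupport_subset : multiSupport κ Ω S u ⊆ S :=
  fun _ ⟨_, _, _, _, _, hY, _⟩ => hY.1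

section Null

open scoped NNReal

/-- The points of `Q` at which both `Φ` and the dual potential are differentiable do not support
twice. -/
lemma measure_eq_zero_of_mapsTo_multiSupport {P : Type*} [NormedAddCommGroup P]
    [NormedSpace ℝ P] [FiniteDimensional ℝ P] [MeasurableSpace P] [BorelSpace P] (μ : Measure P)
    [μ.IsAddHaarMeasure] (hP : n ≤ Module.finrank ℝ P + 1) (hκ0 : 0 < κ) (hκ1 : κ < 1)
    (hc₁ : 0 < c₁) (hΩ : Ω ⊆ unitSphere n) (hΩconn : IsPreconnected Ω)
    (hA : HypA κ c₁ c₂ Ω S E s) (hu : ∀ x ∈ Ω, u x ∈ Icc c₁ c₂) {Q : Set P} {Φ : P → Rn n}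
    {K C : ℝ≥0} (hΦ : LipschitzOnWith K Φ Q)
    (hC : ∀ q ∈ Q, ∀ p ∈ Q, ‖q - p‖ ≤ C * ‖Φ q - Φ p‖)
    (hΦQ : MapsTo Φ Q (multiSupport κ Ω S u)) : μ Q = 0 := by
  have hpotential := (lipschitzWith_dualPotential hκ0.le
    ((fun x => u x • x) '' Ω)).lipschitzOnWith.comp hΦ (mapsTo_univ _ _)
  refine measure_eq_zero_iff_ae_notMem.2 ?_
  filter_upwards [ae_posTangentConeAt_eq_univ μ Q, hΦ.ae_differentiableWithinAt_of_mem,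
    hpotential.ae_differentiableWithinAt_of_mem] with p hcone hdΦ hdf hp
  obtain ⟨x₁, hx₁, x₂, hx₂, hne, h₁, h₂⟩ := hΦQ hp
  have hle {x : Rn n} (hx : x ∈ Ω) (q : P) (_ : q ∈ Q) :=
    dualPotential_le hκ0.le (mem_image_of_mem (fun x => u x • x) hx) (Φ q)
  have heq : u x₁ • x₁ = u x₂ • x₂ := eq_of_le_opticalPath_of_hasFDerivWithinAt hP hκ0 hκ1 hc₁ hΩ
    hΩconn hA hp (hcone hp) (fun q hq => multiSupport_subset (hΦQ hq)) (hdΦ hp).hasFDerivWithinAt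
    (hdf hp).hasFDerivWithinAt (fun q hq => hC q hq p hp) (smul_mem_Gam hx₁ (hu x₁ hx₁))
    (smul_mem_Gam hx₂ (hu x₂ hx₂)) (hle hx₁)
    (dualPotential_eq_of_mem_subdiff hκ0 hκ1 hc₁ hΩ hu hx₁ h₁) (hle hx₂)
    (dualPotential_eq_of_mem_subdiff hκ0 hκ1 hc₁ hΩ hu hx₂ h₂)
  apply hne
  rw [← dir_smul (norm_eq_one_of_mem hΩ hx₁) (hc₁.trans_le (hu x₁ hx₁).1), heq,
    dir_smul (norm_eq_one_of_mem hΩ hx₂) (hc₁.trans_le (hu x₂ hx₂).1)]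

lemma HypA.exists_bilipschitz_chart (hn : 1 ≤ n) (hκ0 : 0 < κ) (hc₁ : 0 < c₁) (hc₂ : 0 < c₂)
    (hΩ : Ω ⊆ unitSphere n) (hA : HypA κ c₁ c₂ Ω S E s) (hB : HypB κ c₁ c₂ Ω S)
    (hΓ : (Gam Ω c₁ c₂).Nonempty) :
    ∃ (Ψ : Rn n → Rn (n - 1)) (K C : ℝ≥0), ∀ Y ∈ S, ∀ Z ∈ S,
      dist Y Z ≤ K * dist (Ψ Y) (Ψ Z) ∧ dist (Ψ Y) (Ψ Z) ≤ C * dist Y Z := by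
  obtain ⟨X₀, hX₀⟩ := hΓ
  obtain ⟨π, hπ⟩ := exists_norm_sq_eq_norm_sq_sub_inner_sq hn
    (norm_eq_one_of_mem hΩ ((mem_Gam_iff hΩ hc₁).1 hX₀).1)
  obtain ⟨K, hK0, hK⟩ := hA.exists_norm_sub_le_mul_dir_sub hΩ hc₁
  refine ⟨fun Y => π (dir (Y - X₀)), (K * (2 / κ)).toNNReal, (κ / c₂).toNNReal,
    fun Y hY Z hZ => ⟨?_, ?_⟩⟩
  · rw [Real.coe_toNNReal _ (by positivity), dist_eq_norm, dist_eq_norm, mul_assoc]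
    refine (hK X₀ hX₀ Y hY Z hZ).trans (mul_le_mul_of_nonneg_left ?_ hK0.le)
    have hcap {Y : Rn n} (hY : Y ∈ S) : κ ≤ inner ℝ (dir (Y - X₀)) (dir X₀) := by
      rw [real_inner_comm]; exact hA.refracts X₀ hX₀ Y hY
    exact norm_sub_le_mul_of_norm_sq_eq hπ (hA.norm_dir_sub hX₀ hY) (hA.norm_dir_sub hX₀ hZ) hκ0
      (hcap hY) (hcap hZ)
  · have hfar := hB.two_mul_div_le_norm_sub hκ0 hc₁ hΩ hA hX₀ hY
    have hπle (v : Rn n) : ‖π v‖ ≤ ‖v‖ := by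
      refine le_of_sq_le_sq ?_ (norm_nonneg v)
      rw [hπ]; nlinarith [sq_nonneg (inner ℝ v (dir X₀))]
    rw [Real.coe_toNNReal _ (by positivity), dist_eq_norm, dist_eq_norm, ← map_sub]
    calc ‖π (dir (Y - X₀) - dir (Z - X₀))‖ ≤ 2 / ‖Y - X₀‖ * ‖(Y - X₀) - (Z - X₀)‖ :=
          (hπle _).trans (norm_dir_sub_dir_le (sub_ne_zero.2 (hA.ne hX₀ hY))
            (sub_ne_zero.2 (hA.ne hX₀ hZ)))
      _ ≤ 2 / (2 * (c₂ / κ)) * ‖Y - Z‖ := by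
          rw [sub_sub_sub_cancel_right]; gcongr
      _ = κ / c₂ * ‖Y - Z‖ := by field_simp

theorem hausdorff_multiSupport_eq_zero (hn : 1 ≤ n) (hκ0 : 0 < κ) (hκ1 : κ < 1) (hc₁ : 0 < c₁)
    (hΩ : Ω ⊆ unitSphere n) (hΩconn : IsPreconnected Ω) (hA : HypA κ c₁ c₂ Ω S E s)
    (hB : HypB κ c₁ c₂ Ω S) (hu : ∀ x ∈ Ω, u x ∈ Icc c₁ c₂) :
    hausdorff n (multiSupport κ Ω S u) = 0 := by
  set M := multiSupport κ Ω S u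
  rcases M.eq_empty_or_nonempty with hempty | ⟨_, x₀, hx₀, -⟩
  · rw [hempty, measure_empty]
  have hux₀ := hu x₀ hx₀
  obtain ⟨Ψ, K, C, hΨ⟩ := hA.exists_bilipschitz_chart hn hκ0 hc₁
    (hc₁.trans_le (hux₀.1.trans hux₀.2)) hΩ hB ⟨_, smul_mem_Gam hx₀ hux₀⟩
  replace hΨ : ∀ Y ∈ M, ∀ Z ∈ M, dist Y Z ≤ K * dist (Ψ Y) (Ψ Z) ∧
      dist (Ψ Y) (Ψ Z) ≤ C * dist Y Z :=
    fun Y hY Z hZ => hΨ Y (multiSupport_subset hY) Z (multiSupport_subset hZ)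
  have hinj : InjOn Ψ M := fun Y hY Z hZ h => by
    simpa [h] using (hΨ Y hY Z hZ).1
  have hinv := hinj.leftInvOn_invFunOn
  have hcast := natCast_sub_one_eq_finrank hn
  have hnull : μH[(n : ℝ) - 1] (Ψ '' M) = 0 := by
    rw [hcast]
    refine measure_eq_zero_of_mapsTo_multiSupport (Φ := Function.invFunOn Ψ M) (K := K) (C := C) _
      (by simp; omega) hκ0 hκ1 hc₁ hΩ hΩconn hA hu (LipschitzOnWith.of_dist_le_mul ?_) ?_ ?_
    · rintro _ ⟨Y, hY, rfl⟩ _ ⟨Z, hZ, rfl⟩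
      rw [hinv hY, hinv hZ]
      exact (hΨ Y hY Z hZ).1
    · rintro _ ⟨Y, hY, rfl⟩ _ ⟨Z, hZ, rfl⟩
      rw [hinv hY, hinv hZ, ← dist_eq_norm, ← dist_eq_norm]
      exact (hΨ Y hY Z hZ).2
    · rintro _ ⟨Y, hY, rfl⟩
      rwa [hinv hY]
  have hle := hausdorffMeasure_le_mul_image (by rw [hcast]; positivity : 0 ≤ (n : ℝ) - 1)
    (fun Y hY Z hZ => (hΨ Y hY Z hZ).1)
  rw [hnull, mul_zero] at hle
  exact le_antisymm hle zero_le

end Null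

end

/-! ### The measure condition -/

section

section Density

variable {X : Type*} [MeasurableSpace X]

lemma withDensity_ofReal_le_smul (μ : Measure X) (f : X → ℝ) :
    μ.withDensity (fun x => ENNReal.ofReal (f x)) ≤ eLpNorm f ∞ μ • μ := by
  rw [← withDensity_const, eLpNorm_exponent_top]
  refine withDensity_mono ?_
  filter_upwards [ae_le_eLpNormEssSup (f := f) (μ := μ)] with x hx
  exact (ENNReal.ofReal_le_ofReal (le_abs_self _)).trans (ofReal_norm (f x) ▸ hx)

lemma withDensity_le_smul_of_ae_le {ν : Measure X} {G : X → ℝ≥0∞} (hG : AEMeasurable G ν)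
    {a : ℝ≥0∞} (h : ∀ᵐ x ∂ν.withDensity G, G x ≤ a) : ν.withDensity G ≤ a • ν := by
  rw [← withDensity_const]
  refine withDensity_mono ?_
  filter_upwards [(ae_withDensity_iff' hG).1 h] with x hx
  by_cases hx0 : G x = 0
  · rw [hx0]; exact zero_le
  · exact hx hx0

end Density

variable {n : ℕ} {κ c₁ c₂ : ℝ} {Ω S : Set (Rn n)} {E : Rn n → Set (Rn n)}
  {s : Rn n → Rn n → ℝ} {u : Rn n → ℝ}

lemma measurableSet_iUnion_subdiff_of_isCompact (hκ0 : 0 < κ) (hκ1 : κ < 1) (hc₁ : 0 < c₁)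
    (hΩ : Ω ⊆ unitSphere n) (hS : MeasurableSet S) (hu : IsRefractor κ c₁ c₂ Ω S u)
    {K : Set (Rn n)} (hK : IsCompact K) (hKΩ : K ⊆ Ω) :
    MeasurableSet (⋃ x ∈ K, subdiff κ Ω S u x) := by
  have : CompactSpace K := isCompact_iff_compactSpace.1 hK
  have hcont : Continuous fun x : K => u x • (x : Rn n) :=
    (continuousOn_iff_continuous_domRestrict.1
      ((hu.continuousOn hκ0 hκ1 hc₁ hΩ).mono hKΩ)).smul continuous_subtype_val
  let D : Set (K × Rn n) := ⋂ x ∈ Ω, {p | opticalPath κ (u p.1 • (p.1 : Rn n)) p.2 ≤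
    opticalPath κ (u x • x) p.2}
  have hD : IsClosed D :=
    isClosed_biInter fun x _ => isClosed_le
      (continuous_opticalPath (hcont.comp continuous_fst) continuous_snd)
      (continuous_opticalPath continuous_const continuous_snd)
  have hproj : (⋃ x ∈ K, subdiff κ Ω S u x) = S ∩ Prod.snd '' D := by
    ext Y
    simp only [D, mem_iUnion, mem_subdiff_iff hκ0 hκ1 hc₁ hΩ hu.1, mem_inter_iff, mem_image,
      mem_iInter, mem_ofPred, Prod.exists, exists_eq_right, Subtype.exists, exists_prop]
    tauto
  rw [hproj]
  exact hS.inter (isClosedMap_snd_of_compactSpace D hD).measurableSet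

lemma measurableSet_iUnion_subdiff_of_isOpen (hκ0 : 0 < κ) (hκ1 : κ < 1) (hc₁ : 0 < c₁)
    (hΩ : Ω ⊆ unitSphere n) (hS : MeasurableSet S) (hu : IsRefractor κ c₁ c₂ Ω S u)
    {V : Set (Rn n)} (hV : IsOpen V) (hVΩ : V ∩ unitSphere n ⊆ Ω) :
    MeasurableSet (⋃ x ∈ V ∩ unitSphere n, subdiff κ Ω S u x) := by
  obtain ⟨F, hF, hFV, rfl, -⟩ := hV.exists_iUnion_isClosed
  rw [iUnion_inter, biUnion_iUnion]
  exact MeasurableSet.iUnion fun k =>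
    measurableSet_iUnion_subdiff_of_isCompact hκ0 hκ1 hc₁ hΩ hS hu
      ((isCompact_sphere _ _).inter_left (hF k))
      ((inter_subset_inter_left _ (hFV k)).trans hVΩ)

lemma tracing_iUnion_subdiff_subset {B : Set (Rn n)} (hB : B ⊆ Ω) :
    tracing κ Ω S u (⋃ x ∈ B, subdiff κ Ω S u x) ⊆
      B ∪ tracing κ Ω S u (multiSupport κ Ω S u) := by
  rintro x ⟨hx, Y, hY, hYx⟩
  obtain ⟨x', hx', hYx'⟩ := mem_iUnion₂.1 hY
  by_cases h : x = x'
  · exact Or.inl (h ▸ hx')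
  · exact Or.inr ⟨hx, Y, ⟨x, hx, x', hB hx', h, hYx, hYx'⟩, hYx⟩

lemma IsWeakSolution.sourceMeasure_tracing_eq_zero {f : Rn n → ℝ} {ν : Measure (Rn n)}
    (hu : IsWeakSolution κ c₁ c₂ Ω S f ν u) (hS : MeasurableSet S) {M : Set (Rn n)} (hMS : M ⊆ S)
    (hM : ν M = 0) : sourceMeasure Ω f (tracing κ Ω S u M) = 0 := by
  have hM' : ν (toMeasurable ν M ∩ S) = 0 :=
    measure_mono_null inter_subset_left ((measure_toMeasurable M).trans hM)
  rw [← hu.2 _ ((measurableSet_toMeasurable _ _).inter hS) inter_subset_right] at hM'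
  refine measure_mono_null ?_ hM'
  rintro x ⟨hx, Y, hY, hYx⟩
  exact ⟨hx, Y, ⟨subset_toMeasurable _ _ hY, hMS hY⟩, hYx⟩

lemma IsWeakSolution.measure_iUnion_subdiff_le (hn : 1 ≤ n) (hκ0 : 0 < κ) (hκ1 : κ < 1)
    (hc₁ : 0 < c₁) (hΩ : Ω ⊆ unitSphere n) (hΩconn : IsPreconnected Ω) (hS : MeasurableSet S)
    (hA : HypA κ c₁ c₂ Ω S E s) (hB : HypB κ c₁ c₂ Ω S) {f : Rn n → ℝ} {ν : Measure (Rn n)}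
    (hν : ν ≪ hausdorff n) (hu : IsWeakSolution κ c₁ c₂ Ω S f ν u) {B : Set (Rn n)} (hBΩ : B ⊆ Ω)
    (hmeas : MeasurableSet (⋃ x ∈ B, subdiff κ Ω S u x)) :
    ν (⋃ x ∈ B, subdiff κ Ω S u x) ≤ sourceMeasure Ω f B := by
  have hmulti : sourceMeasure Ω f (tracing κ Ω S u (multiSupport κ Ω S u)) = 0 :=
    hu.sourceMeasure_tracing_eq_zero hS multiSupport_subset
      (hν (hausdorff_multiSupport_eq_zero hn hκ0 hκ1 hc₁ hΩ hΩconn hA hB hu.1.1))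
  rw [← hu.2 _ hmeas (iUnion₂_subset fun x _ Y hY => hY.1)]
  refine (measure_mono (tracing_iUnion_subdiff_subset hBΩ)).trans ((measure_union_le _ _).trans ?_)
  rw [hmulti, add_zero]

theorem IsWeakSolution.measureCondition (hn : 1 ≤ n) (hκ0 : 0 < κ) (hκ1 : κ < 1) (hc₁ : 0 < c₁)
    (hΩ : Ω ⊆ unitSphere n) (hΩconn : IsPreconnected Ω) (hS : MeasurableSet S)
    (hA : HypA κ c₁ c₂ Ω S E s) (hB : HypB κ c₁ c₂ Ω S) {f : Rn n → ℝ}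
    (hf : MemLp f ∞ ((hausdorff n).restrict Ω)) {ν : Measure (Rn n)} (hν : ν ≪ hausdorff n)
    {g : Rn n → ℝ} (hg_meas : AEMeasurable g ν) {α : ℝ}
    (hg_le : ∀ᵐ y ∂((hausdorff n).restrict S), g y ≤ α)
    (hg : (hausdorff n).restrict S = ν.withDensity (fun y => ENNReal.ofReal (g y)))
    (hu : IsWeakSolution κ c₁ c₂ Ω S f ν u) : MeasureCondition κ Ω S u := by
  obtain ⟨Cs, hcap⟩ := exists_hausdorff_cap_le hn
  set Cf := eLpNorm f ∞ ((hausdorff n).restrict Ω)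
  refine ⟨(ENNReal.ofReal α * (Cf * Cs)).toReal, fun c σ hσ hcσ => ?_⟩
  set B := Metric.ball c σ ∩ unitSphere n
  set A := ⋃ x ∈ B, subdiff κ Ω S u x
  have hAS : A ⊆ S := iUnion₂_subset fun x _ Y hY => hY.1
  have hA_meas : MeasurableSet A :=
    measurableSet_iUnion_subdiff_of_isOpen hκ0 hκ1 hc₁ hΩ hS hu.1 Metric.isOpen_ball hcσ
  have htarget : (hausdorff n).restrict S ≤ ENNReal.ofReal α • ν := by
    rw [hg] at hg_le ⊢
    exact withDensity_le_smul_of_ae_le hg_meas.ennreal_ofReal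
      (hg_le.mono fun y hy => ENNReal.ofReal_le_ofReal hy)
  have hsource : sourceMeasure Ω f B ≤ Cf * hausdorff n B :=
    (withDensity_ofReal_le_smul _ f B).trans (mul_le_mul' le_rfl (Measure.restrict_le_self B))
  have hfinite : ENNReal.ofReal α * (Cf * Cs) ≠ ∞ :=
    ENNReal.mul_ne_top ENNReal.ofReal_ne_top (ENNReal.mul_ne_top hf.2.ne ENNReal.coe_ne_top)
  calc hausdorff n A = (hausdorff n).restrict S A := (Measure.restrict_eq_self _ hAS).symm
    _ ≤ ENNReal.ofReal α * ν A := htarget A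
    _ ≤ ENNReal.ofReal α * sourceMeasure Ω f B := mul_le_mul' le_rfl
      (hu.measure_iUnion_subdiff_le hn hκ0 hκ1 hc₁ hΩ hΩconn hS hA hB hν hcσ hA_meas)
    _ ≤ ENNReal.ofReal α * (Cf * (Cs * ENNReal.ofReal (σ ^ (n - 1)))) := by
      gcongr
      exact hsource.trans (by gcongr; exact hcap c σ hσ)
    _ = ENNReal.ofReal ((ENNReal.ofReal α * (Cf * Cs)).toReal * σ ^ (n - 1)) := by
      rw [ENNReal.ofReal_mul ENNReal.toReal_nonneg, ENNReal.ofReal_toReal hfinite]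
      ring

end

/-! ### Hölder continuity of the set of supporting points -/

section

section MixedDifference

variable {V : Type*} [NormedAddCommGroup V] [InnerProductSpace ℝ V]

lemma norm_sub_norm_mul_add (a b : V) :
    (‖a‖ - ‖b‖) * (‖a‖ + ‖b‖) = inner ℝ (a - b) (a + b) := by
  rw [inner_sub_left, inner_add_right, inner_add_right, real_inner_self_eq_norm_sq,
    real_inner_self_eq_norm_sq, real_inner_comm a b]
  ring

lemma abs_norm_mixed_difference_mul_le (X X' Y Y' : V) :
    |(‖X - Y‖ - ‖X - Y'‖) - (‖X' - Y‖ - ‖X' - Y'‖)| * (‖X - Y‖ + ‖X - Y'‖) ≤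
      4 * (‖X - X'‖ * ‖Y - Y'‖) := by
  have hsplit : ((‖X - Y‖ - ‖X - Y'‖) - (‖X' - Y‖ - ‖X' - Y'‖)) * (‖X - Y‖ + ‖X - Y'‖) =
      inner ℝ (Y' - Y) ((2 : ℝ) • (X - X')) +
        (‖X' - Y‖ - ‖X' - Y'‖) * ((‖X' - Y‖ - ‖X - Y‖) + (‖X' - Y'‖ - ‖X - Y'‖)) := by
    have h := norm_sub_norm_mul_add (X - Y) (X - Y')
    have h' := norm_sub_norm_mul_add (X' - Y) (X' - Y')
    rw [sub_sub_sub_cancel_left] at h h'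
    have : (2 : ℝ) • (X - X') = (X - Y + (X - Y')) - (X' - Y + (X' - Y')) := by module
    rw [this, inner_sub_right]
    linear_combination h - h'
  have hinner : |inner ℝ (Y' - Y) ((2 : ℝ) • (X - X'))| ≤ 2 * (‖X - X'‖ * ‖Y - Y'‖) := by
    refine (abs_real_inner_le_norm _ _).trans_eq ?_
    rw [norm_smul, Real.norm_two, norm_sub_rev Y' Y]
    ring
  have hdist : ∀ Z : V, |‖X' - Z‖ - ‖X - Z‖| ≤ ‖X - X'‖ := fun Z => by
    simpa [norm_sub_rev] using abs_norm_sub_norm_le (X' - Z) (X - Z)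
  have hproduct : |(‖X' - Y‖ - ‖X' - Y'‖) * ((‖X' - Y‖ - ‖X - Y‖) + (‖X' - Y'‖ - ‖X - Y'‖))| ≤
      ‖Y - Y'‖ * (2 * ‖X - X'‖) := by
    rw [abs_mul]
    gcongr
    · simpa [norm_sub_rev] using abs_norm_sub_norm_le (X' - Y) (X' - Y')
    · linarith [abs_add_le (‖X' - Y‖ - ‖X - Y‖) (‖X' - Y'‖ - ‖X - Y'‖), hdist Y, hdist Y']
  rw [← abs_of_nonneg (by positivity : 0 ≤ ‖X - Y‖ + ‖X - Y'‖), ← abs_mul, hsplit]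
  linarith [abs_add_le (inner ℝ (Y' - Y) ((2 : ℝ) • (X - X')))
    ((‖X' - Y‖ - ‖X' - Y'‖) * ((‖X' - Y‖ - ‖X - Y‖) + (‖X' - Y'‖ - ‖X - Y'‖)))]

lemma abs_opticalPath_mixed_difference_le {κ ℓ : ℝ} (hκ : 0 ≤ κ) (hℓ : 0 < ℓ) {X Y : V}
    (h : ℓ ≤ ‖Y - X‖) (X' Y' : V) :
    |(opticalPath κ X Y - opticalPath κ X Y') - (opticalPath κ X' Y - opticalPath κ X' Y')| ≤
      4 * κ / ℓ * (‖X - X'‖ * ‖Y - Y'‖) := by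
  set Δ := (‖X - Y‖ - ‖X - Y'‖) - (‖X' - Y‖ - ‖X' - Y'‖) with hΔ_def
  have hΔ : |Δ| ≤ 4 * (‖X - X'‖ * ‖Y - Y'‖) / ℓ := by
    refine (le_div_iff₀ hℓ).2 (le_trans ?_ (abs_norm_mixed_difference_mul_le X X' Y Y'))
    gcongr
    exact (h.trans_eq (norm_sub_rev _ _)).trans (le_add_of_nonneg_right (norm_nonneg _))
  calc _ = |κ * Δ| := by rw [hΔ_def]; unfold opticalPath; ring_nf
    _ = κ * |Δ| := by rw [abs_mul, abs_of_nonneg hκ]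
    _ ≤ κ * (4 * (‖X - X'‖ * ‖Y - Y'‖) / ℓ) := by gcongr
    _ = _ := by ring

end MixedDifference

section Exponent

open Filter Topology

lemma le_two_mul_rpow {δ γ : ℝ} (hδ0 : 0 ≤ δ) (hδ2 : δ ≤ 2) (hγ0 : 0 ≤ γ) (hγ1 : γ ≤ 1) :
    δ ≤ 2 * δ ^ γ := by
  have hhalf : (δ / 2) ^ (1 : ℝ) ≤ (δ / 2) ^ γ :=
    Real.rpow_le_rpow_of_exponent_ge' (by positivity) (by linarith) hγ0 hγ1
  rw [Real.rpow_one] at hhalf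
  have : (δ / 2) ^ γ ≤ δ ^ γ := Real.rpow_le_rpow (by positivity) (by linarith) hγ0
  linarith

lemma nonpos_of_forall_le_mul {p C η₀ : ℝ} (hη₀ : 0 < η₀) (h : ∀ η ∈ Ioc 0 η₀, p ≤ C * η) :
    p ≤ 0 := by
  have hlim : Tendsto (fun η => C * η) (𝓝[>] 0) (𝓝 0) := by
    simpa using ((continuous_const_mul C).tendsto 0).mono_left nhdsWithin_le_nhds
  exact ge_of_tendsto hlim (Filter.eventually_of_mem (Ioc_mem_nhdsGT hη₀) h)

/-- Optimizing over `η` means taking `η² = bδ / L`, which turns `L^m ≤ C η` into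
`L^(2m+1) ≤ C² b δ`. -/
lemma le_mul_rpow_of_forall_pow_le {m : ℕ} {b C η₀ L δ : ℝ} (hb : 0 < b)
    (hη₀ : 0 < η₀) (hL : 0 < L) (hδ0 : 0 ≤ δ) (hδ2 : δ ≤ 2)
    (h : ∀ η ∈ Ioc 0 η₀, b * δ ≤ L * η ^ 2 → L ^ m ≤ C * η) :
    L ≤ ((C ^ 2 * b) ^ (1 / (2 * m + 1 : ℝ)) + 2 * b / η₀ ^ 2) * δ ^ (1 / (2 * m + 1 : ℝ)) := by
  set γ : ℝ := 1 / (2 * m + 1) with hγ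
  have hγ0 : 0 < γ := by positivity
  have hγ1 : γ ≤ 1 := (div_le_one (by positivity)).2 (le_add_of_nonneg_left (by positivity))
  rcases hδ0.eq_or_lt with rfl | hδ
  · have : L ^ m ≤ 0 :=
      nonpos_of_forall_le_mul hη₀ fun η hη => h η hη (by rw [mul_zero]; positivity)
    exact absurd this (not_le.2 (by positivity))
  rw [add_mul]
  by_cases hη : b * δ ≤ L * η₀ ^ 2
  · set η := √(b * δ / L)
    have hη_sq : L * η ^ 2 = b * δ := by rw [Real.sq_sqrt (by positivity)]; field_simp
    have hη_le : η ≤ η₀ := Real.sqrt_le_iff.2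
      ⟨hη₀.le, (div_le_iff₀ hL).2 (by linarith)⟩
    have hη_bound := h η ⟨Real.sqrt_pos.2 (by positivity), hη_le⟩ hη_sq.ge
    have hpow : L ^ (2 * m + 1) ≤ C ^ 2 * b * δ := by
      calc L ^ (2 * m + 1) = (L ^ m) ^ 2 * L := by ring
        _ ≤ (C * η) ^ 2 * L := by gcongr
        _ = C ^ 2 * b * δ := by linear_combination C ^ 2 * hη_sq
    have hL_eq : (L ^ (2 * m + 1)) ^ γ = L := by
      rw [hγ, one_div]
      exact_mod_cast Real.pow_rpow_inv_natCast hL.le (Nat.succ_ne_zero (2 * m))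
    refine le_add_of_le_of_nonneg ?_ (by positivity)
    rw [← Real.mul_rpow (by positivity) hδ0, ← hL_eq]
    exact Real.rpow_le_rpow (by positivity) hpow hγ0.le
  · refine le_add_of_nonneg_of_le (by positivity) ?_
    calc L ≤ b / η₀ ^ 2 * δ := by
          rw [div_mul_eq_mul_div, le_div_iff₀ (by positivity)]
          exact (not_le.1 hη).le
      _ ≤ b / η₀ ^ 2 * (2 * δ ^ γ) := by gcongr; exact le_two_mul_rpow hδ0 hδ2 hγ0.le hγ1
      _ = _ := by ring

end Exponent

variable {n : ℕ} {κ c₁ c₂ : ℝ} {Ω S : Set (Rn n)} {E : Rn n → Set (Rn n)}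
  {s : Rn n → Rn n → ℝ} {u : Rn n → ℝ}

lemma IsRefractor.abs_opticalPath_mixed_difference_le (hκ0 : 0 < κ) (hκ1 : κ < 1) (hc₁ : 0 < c₁)
    (hΩ : Ω ⊆ unitSphere n) (hA : HypA κ c₁ c₂ Ω S E s) (hB : HypB κ c₁ c₂ Ω S)
    (hu : IsRefractor κ c₁ c₂ Ω S u) {x x' Y : Rn n} (hx : x ∈ Ω) (hx' : x' ∈ Ω) (hY : Y ∈ S)
    (Y' : Rn n) :
    |(opticalPath κ (u x • x) Y - opticalPath κ (u x • x) Y') -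
        (opticalPath κ (u x' • x') Y - opticalPath κ (u x' • x') Y')| ≤
      2 * κ ^ 2 / (1 - κ) * (‖x - x'‖ * ‖Y - Y'‖) := by
  have hc₂ : 0 < c₂ := hc₁.trans_le ((hu.1 x hx).1.trans (hu.1 x hx).2)
  have hfar := hB.two_mul_div_le_norm_sub hκ0 hc₁ hΩ hA (hu.smul_mem_Gam hx) hY
  have hκ' : 1 - κ ≠ 0 := (sub_pos.2 hκ1).ne'
  calc _ ≤ 4 * κ / (2 * (c₂ / κ)) * (‖u x • x - u x' • x'‖ * ‖Y - Y'‖) :=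
        NearField.abs_opticalPath_mixed_difference_le hκ0.le (by positivity) hfar _ _
    _ ≤ 4 * κ / (2 * (c₂ / κ)) * ((κ * c₂ / (1 - κ) + c₂) * ‖x - x'‖ * ‖Y - Y'‖) := by
        gcongr
        exact hu.norm_smul_sub_smul_le hκ0 hκ1 hc₁ hΩ hx hx'
    _ = _ := by field_simp; ring

lemma IsRefractor.opticalPath_le_add (hκ0 : 0 < κ) (hκ1 : κ < 1) (hc₁ : 0 < c₁)
    (hΩ : Ω ⊆ unitSphere n) (hA : HypA κ c₁ c₂ Ω S E s) (hB : HypB κ c₁ c₂ Ω S)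
    (hu : IsRefractor κ c₁ c₂ Ω S u) {x₁ x₂ Y₁ Y₂ : Rn n} (hx₁ : x₁ ∈ Ω) (hx₂ : x₂ ∈ Ω)
    (hY₁ : Y₁ ∈ subdiff κ Ω S u x₁) (hY₂ : Y₂ ∈ S) :
    opticalPath κ (u x₁ • x₁) Y₂ ≤ opticalPath κ (u x₂ • x₂) Y₂ +
      2 * κ ^ 2 / (1 - κ) * (‖x₁ - x₂‖ * ‖Y₁ - Y₂‖) := by
  rw [mem_subdiff_iff hκ0 hκ1 hc₁ hΩ hu.1] at hY₁
  have hmin := hY₁.2 x₂ hx₂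
  have hmixed := hu.abs_opticalPath_mixed_difference_le hκ0 hκ1 hc₁ hΩ hA hB hx₁ hx₂ hY₁.1 Y₂
  linarith [(abs_le.1 hmixed).1]

lemma IsRefractor.mem_iUnion_subdiff_of_le (hκ0 : 0 < κ) (hκ1 : κ < 1) (hc₁ : 0 < c₁)
    (hΩ : Ω ⊆ unitSphere n) (hu : IsRefractor κ c₁ c₂ Ω S u) {x₁ Y : Rn n} (hx₁ : x₁ ∈ Ω)
    (hY : Y ∈ S) {η r : ℝ} (hη : 0 ≤ η) (hηr : η < r) (hball : Metric.ball x₁ r ∩ unitSphere n ⊆ Ω)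
    (hout : ∀ x ∈ Ω, η ≤ ‖x - x₁‖ →
      opticalPath κ (u x₁ • x₁) Y ≤ opticalPath κ (u x • x) Y) :
    Y ∈ ⋃ x ∈ Metric.ball x₁ r ∩ unitSphere n, subdiff κ Ω S u x := by
  have hsub : Metric.closedBall x₁ η ⊆ Metric.ball x₁ r := Metric.closedBall_subset_ball hηr
  set B := Metric.closedBall x₁ η ∩ unitSphere n
  have hBΩ : B ⊆ Ω := (inter_subset_inter_left _ hsub).trans hball
  have hB_compact : IsCompact B := (isCompact_sphere _ _).inter_left Metric.isClosed_closedBall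
  have hx₁B : x₁ ∈ B := ⟨Metric.mem_closedBall_self hη, hΩ hx₁⟩
  have hcont : ContinuousOn (fun x => opticalPath κ (u x • x) Y) B := by
    have hu_cont : ContinuousOn u B := (hu.continuousOn hκ0 hκ1 hc₁ hΩ).mono hBΩ
    unfold opticalPath
    fun_prop
  obtain ⟨z, hz, hmin⟩ := hB_compact.exists_isMinOn ⟨x₁, hx₁B⟩ hcont
  refine mem_iUnion₂.2 ⟨z, ⟨hsub hz.1, hz.2⟩,
    (mem_subdiff_iff hκ0 hκ1 hc₁ hΩ hu.1).2 ⟨hY, fun x hx => ?_⟩⟩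
  by_cases hxη : ‖x - x₁‖ ≤ η
  · exact hmin ⟨mem_closedBall_iff_norm.2 hxη, hΩ hx⟩
  · exact (hmin hx₁B).trans (hout x hx (not_le.1 hxη).le)

lemma IsRefractor.exists_thickening_subset_iUnion_subdiff (hκ0 : 0 < κ) (hκ1 : κ < 1)
    (hc₁ : 0 < c₁) (hc₂ : 0 < c₂) (hΩ : Ω ⊆ unitSphere n) (hA : HypA κ c₁ c₂ Ω S E s)
    (hB : HypB κ c₁ c₂ Ω S) (hC : HypC κ c₁ c₂ Ω E s) (hu : IsRefractor κ c₁ c₂ Ω S u) :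
    ∃ a b : ℝ, 0 < a ∧ 0 < b ∧ ∀ x₁ ∈ Ω, ∀ x₂ ∈ Ω, ∀ Y₁ ∈ subdiff κ Ω S u x₁,
      ∀ Y₂ ∈ subdiff κ Ω S u x₂, ∀ η, 0 < η → Metric.ball x₁ (2 * η) ∩ unitSphere n ⊆ Ω →
        b * ‖x₁ - x₂‖ ≤ ‖Y₁ - Y₂‖ * η ^ 2 →
          Metric.thickening (a * ‖Y₁ - Y₂‖ ^ 2 * η)
              (targetCurvePt κ s (u x₁ • x₁) Y₁ Y₂ '' Icc (1 / 4) (3 / 4)) ∩ S ⊆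
            ⋃ x ∈ Metric.ball x₁ (2 * η) ∩ unitSphere n, subdiff κ Ω S u x := by
  obtain ⟨c, C₀, hc, hC₀, hgain⟩ := exists_opticalPath_gain hκ0 hκ1 hc₁ hc₂ hΩ hA hB hC
  have : 0 < 1 - κ := sub_pos.2 hκ1
  set K := 2 * κ ^ 2 / (1 - κ)
  have hK : 0 < K := by positivity
  refine ⟨c / (2 * K), 2 * C₀ * K / c, by positivity, by positivity, ?_⟩
  rintro x₁ hx₁ x₂ hx₂ Y₁ hY₁ Y₂ hY₂ η hη hball hδ Y ⟨hY_near, hYS⟩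
  obtain ⟨_, ⟨l, hl, rfl⟩, hY_dist⟩ := Metric.mem_thickening_iff.1 hY_near
  rw [dist_eq_norm] at hY_dist
  refine hu.mem_iUnion_subdiff_of_le hκ0 hκ1 hc₁ hΩ hx₁ hYS hη.le (by linarith) hball
    fun x hx hηx => ?_
  have hmin₁ := ((mem_subdiff_iff hκ0 hκ1 hc₁ hΩ hu.1).1 hY₁).2 x hx
  have hmin₂ := ((mem_subdiff_iff hκ0 hκ1 hc₁ hΩ hu.1).1 hY₂).2 x hx
  have hcross := hu.opticalPath_le_add hκ0 hκ1 hc₁ hΩ hA hB hx₁ hx₂ hY₁ hY₂.1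
  have hYl_gain := hgain _ (hu.smul_mem_Gam hx₁) _ (hu.smul_mem_Gam hx) Y₁ hY₁.1 Y₂ hY₂.1 l hl
    (K * (‖x₁ - x₂‖ * ‖Y₁ - Y₂‖)) (by positivity)
    (hmin₁.trans' (sub_le_self _ (by positivity))) (by linarith)
  rw [dir_smul (norm_eq_one_of_mem hΩ hx) (hc₁.trans_le (hu.1 x hx).1),
    dir_smul (norm_eq_one_of_mem hΩ hx₁) (hc₁.trans_le (hu.1 x₁ hx₁).1)] at hYl_gain
  set Yl := targetCurvePt κ s (u x₁ • x₁) Y₁ Y₂ l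
  have hmixed := (abs_le.1 (hu.abs_opticalPath_mixed_difference_le hκ0 hκ1 hc₁ hΩ hA hB hx hx₁
    hYS Yl)).1
  set L := ‖Y₁ - Y₂‖
  set t := ‖x - x₁‖
  have hmixed_small : K * (t * ‖Y - Yl‖) ≤ c * L ^ 2 * t ^ 2 / 2 := by
    calc K * (t * ‖Y - Yl‖) ≤ K * (t * (c / (2 * K) * L ^ 2 * t)) := by
          gcongr
          exact hY_dist.le.trans (by gcongr)
      _ = _ := by field_simp
  have herror_small : C₀ * (K * (‖x₁ - x₂‖ * L)) ≤ c * L ^ 2 * t ^ 2 / 2 := by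
    calc C₀ * (K * (‖x₁ - x₂‖ * L)) = 2 * C₀ * K / c * ‖x₁ - x₂‖ * (c * L / 2) := by field_simp
      _ ≤ L * η ^ 2 * (c * L / 2) := by gcongr
      _ = c * L ^ 2 * η ^ 2 / 2 := by ring
      _ ≤ c * L ^ 2 * t ^ 2 / 2 := by gcongr
  linarith

lemma IsRefractor.exists_pow_norm_sub_le (hn : 2 ≤ n) (hκ0 : 0 < κ) (hκ1 : κ < 1)
    (hc₁ : 0 < c₁) (hc₂ : 0 < c₂) (hΩ : Ω ⊆ unitSphere n) (hA : HypA κ c₁ c₂ Ω S E s)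
    (hB : HypB κ c₁ c₂ Ω S) (hC : HypC κ c₁ c₂ Ω E s) (hD : HypD κ c₁ c₂ Ω S s)
    (hu : IsRefractor κ c₁ c₂ Ω S u) (hM : MeasureCondition κ Ω S u) :
    ∃ b C η₀ : ℝ, 0 < b ∧ 0 < η₀ ∧ ∀ x₁ ∈ Ω, ∀ x₂ ∈ Ω, ∀ Y₁ ∈ subdiff κ Ω S u x₁,
      ∀ Y₂ ∈ subdiff κ Ω S u x₂, Y₁ ≠ Y₂ → ∀ η ∈ Ioc 0 η₀,
        Metric.ball x₁ (2 * η) ∩ unitSphere n ⊆ Ω → b * ‖x₁ - x₂‖ ≤ ‖Y₁ - Y₂‖ * η ^ 2 →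
          ‖Y₁ - Y₂‖ ^ (2 * (n - 2) + 1) ≤ C * η := by
  obtain ⟨a, b, ha, hb, hthick⟩ :=
    hu.exists_thickening_subset_iUnion_subdiff hκ0 hκ1 hc₁ hc₂ hΩ hA hB hC
  obtain ⟨CM, hCM⟩ := hM
  obtain ⟨μ₀, CD, hμ₀, hCD, hlower⟩ := hD
  obtain ⟨R, hR, hdist⟩ := hA.exists_norm_sub_le hΩ hc₁
  have : 0 ≤ max CM 0 := le_max_right _ _
  refine ⟨b, max CM 0 * 2 ^ (n - 1) / (CD * a ^ (n - 2)), μ₀ / (a * (2 * R) ^ 2), hb,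
    by positivity, ?_⟩
  rintro x₁ hx₁ x₂ hx₂ Y₁ hY₁ Y₂ hY₂ hne η ⟨hη, hηη₀⟩ hball hδ
  have hX₁ := hu.smul_mem_Gam hx₁
  have hLR : ‖Y₁ - Y₂‖ ≤ 2 * R := by
    have h₁ := hdist _ hX₁ Y₁ hY₁.1
    have h₂ := hdist _ hX₁ Y₂ hY₂.1
    rw [norm_sub_rev] at h₂
    linarith [norm_sub_le_norm_sub_add_norm_sub Y₁ (u x₁ • x₁) Y₂]
  have hL : 0 < ‖Y₁ - Y₂‖ := norm_sub_pos_iff.2 hne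
  have hsub := hthick x₁ hx₁ x₂ hx₂ Y₁ hY₁ Y₂ hY₂ η hη hball hδ
  set L := ‖Y₁ - Y₂‖
  have hμ_le : a * L ^ 2 * η ≤ μ₀ := by
    calc a * L ^ 2 * η ≤ a * (2 * R) ^ 2 * η := by gcongr
      _ ≤ μ₀ := by rwa [le_div_iff₀' (by positivity)] at hηη₀
  have hmeasure : CD * (a * L ^ 2 * η) ^ (n - 2) * L ≤ max CM 0 * (2 * η) ^ (n - 1) := by
    refine (ENNReal.ofReal_le_ofReal_iff (by positivity)).1 ?_
    calc _ ≤ hausdorff n _ := hlower _ hX₁ Y₁ hY₁.1 Y₂ hY₂.1 _ (by positivity) hμ_le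
      _ ≤ hausdorff n _ := measure_mono hsub
      _ ≤ ENNReal.ofReal (CM * (2 * η) ^ (n - 1)) := hCM x₁ (2 * η) (by positivity) hball
      _ ≤ _ := ENNReal.ofReal_le_ofReal (by gcongr; exact le_max_left _ _)
  obtain ⟨k, rfl⟩ := Nat.exists_eq_add_of_le' hn
  simp only [Nat.add_sub_cancel, Nat.add_succ_sub_one] at hmeasure ⊢
  rw [div_mul_eq_mul_div, le_div_iff₀ (by positivity)]
  refine le_of_mul_le_mul_right ?_ (pow_pos hη k)
  calc L ^ (2 * k + 1) * (CD * a ^ k) * η ^ k = CD * (a * L ^ 2 * η) ^ k * L := by ring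
    _ ≤ max CM 0 * (2 * η) ^ (k + 1) := hmeasure
    _ = _ := by ring

theorem IsRefractor.exists_norm_sub_le_mul_rpow (hn : 2 ≤ n) (hκ0 : 0 < κ) (hκ1 : κ < 1)
    (hc₁ : 0 < c₁) (hc₂ : 0 < c₂) {U : Set (Rn n)} (hU : IsOpen U) (hΩU : Ω = U ∩ unitSphere n)
    (hA : HypA κ c₁ c₂ Ω S E s) (hB : HypB κ c₁ c₂ Ω S) (hC : HypC κ c₁ c₂ Ω E s)
    (hD : HypD κ c₁ c₂ Ω S s) (hu : IsRefractor κ c₁ c₂ Ω S u) (hM : MeasureCondition κ Ω S u)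
    {K : Set (Rn n)} (hK : IsCompact K) (hKΩ : K ⊆ Ω) :
    ∃ C : ℝ, ∀ x₁ ∈ K, ∀ x₂ ∈ Ω, ∀ Y₁ ∈ subdiff κ Ω S u x₁, ∀ Y₂ ∈ subdiff κ Ω S u x₂,
      ‖Y₁ - Y₂‖ ≤ C * ‖x₁ - x₂‖ ^ (1 / (4 * (n : ℝ) - 5)) := by
  have hΩ : Ω ⊆ unitSphere n := hΩU ▸ inter_subset_right
  obtain ⟨ε, hε, hεU⟩ := hK.exists_thickening_subset_open hU (hKΩ.trans (hΩU ▸ inter_subset_left))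
  obtain ⟨b, C, η₀, hb, hη₀, hpow⟩ :=
    hu.exists_pow_norm_sub_le hn hκ0 hκ1 hc₁ hc₂ hΩ hA hB hC hD hM
  have hexp : 1 / (4 * (n : ℝ) - 5) = 1 / (2 * (2 * (n - 2) + 1 : ℕ) + 1 : ℝ) := by
    push_cast [hn]; ring_nf
  have hη₁ : 0 < min η₀ (ε / 2) := lt_min hη₀ (half_pos hε)
  rw [hexp]
  refine ⟨(C ^ 2 * b) ^ (1 / (2 * (2 * (n - 2) + 1 : ℕ) + 1 : ℝ)) + 2 * b / min η₀ (ε / 2) ^ 2,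
    fun x₁ hx₁ x₂ hx₂ Y₁ hY₁ Y₂ hY₂ => ?_⟩
  rcases eq_or_ne Y₁ Y₂ with rfl | hne
  · rw [sub_self, norm_zero]
    positivity
  have hδ : ‖x₁ - x₂‖ ≤ 2 := by
    refine (norm_sub_le _ _).trans_eq ?_
    rw [norm_eq_one_of_mem hΩ (hKΩ hx₁), norm_eq_one_of_mem hΩ hx₂, one_add_one_eq_two]
  refine le_mul_rpow_of_forall_pow_le hb hη₁ (norm_sub_pos_iff.2 hne)
    (norm_nonneg _) hδ fun η hη => ?_
  refine hpow x₁ (hKΩ hx₁) x₂ hx₂ Y₁ hY₁ Y₂ hY₂ hne η ⟨hη.1, hη.2.trans (min_le_left _ _)⟩ ?_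
  have hηε : 2 * η ≤ ε := by linarith [hη.2.trans (min_le_right _ _)]
  rw [hΩU]
  exact inter_subset_inter_left _ ((Metric.ball_subset_ball hηε).trans
    ((Metric.ball_subset_thickening hx₁ ε).trans hεU))

end

/-! ### The gradient of a refractor -/

section

open Filter Topology Asymptotics

/-- Implicit differentiation: the equation `Φ (v X, X) = const` is only required to hold to first
order at `x₀`, at the price of assuming that `v` is Lipschitz there. -/
lemma hasFDerivAt_of_isLittleO_comp {V : Type*} [NormedAddCommGroup V] [NormedSpace ℝ V]
    {Φ : ℝ × V → ℝ} {v : V → ℝ} {x₀ : V} {c : ℝ} {v' : V →L[ℝ] ℝ} (hc : c ≠ 0)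
    (hΦ : HasFDerivAt Φ (c • (ContinuousLinearMap.fst ℝ ℝ V -
      v'.comp (ContinuousLinearMap.snd ℝ ℝ V))) (v x₀, x₀))
    (hv : (fun X => v X - v x₀) =O[𝓝 x₀] fun X => X - x₀)
    (hΦv : (fun X => Φ (v X, X) - Φ (v x₀, x₀)) =o[𝓝 x₀] fun X => X - x₀) :
    HasFDerivAt v v' x₀ := by
  have hpair : (fun X => (v X, X) - (v x₀, x₀)) =O[𝓝 x₀] fun X => X - x₀ :=
    hv.prod_left (isBigO_refl _ _)
  have hcont : Tendsto (fun X => (v X, X)) (𝓝 x₀) (𝓝 (v x₀, x₀)) :=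
    tendsto_sub_nhds_zero_iff.1 (hpair.trans_tendsto (tendsto_sub_nhds_zero_iff.2 tendsto_id))
  have hlinear := (hΦ.isLittleO.comp_tendsto hcont).trans_isBigO hpair
  refine .of_isLittleO (((hΦv.sub hlinear).const_mul_left c⁻¹).congr_left fun X => ?_)
  simp only [Function.comp_apply, sub_sub_cancel, smul_apply, sub_apply,
    ContinuousLinearMap.comp_apply, ContinuousLinearMap.coe_fst', ContinuousLinearMap.coe_snd',
    Prod.fst_sub, Prod.snd_sub, smul_eq_mul]
  exact inv_mul_cancel_left₀ hc _

section RefractorGradient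

variable {V : Type*} [NormedAddCommGroup V] [InnerProductSpace ℝ V]

/-- The tangential gradient at `x` of a refractor of polar radius `r` that refracts the unit vector
`x` into the unit direction `e`. -/
def refractorGradient (κ r : ℝ) (x e : V) : V :=
  (κ * r / (1 - κ * inner ℝ e x)) • (e - (inner ℝ e x : ℝ) • x)

variable {κ r r' : ℝ} {x x' e e' : V}

lemma abs_inner_le_one (hx : ‖x‖ = 1) (he : ‖e‖ = 1) : |inner ℝ e x| ≤ (1 : ℝ) := by
  simpa [hx, he] using abs_real_inner_le_norm e x

lemma one_sub_le_one_sub_mul {t : ℝ} (hκ : 0 ≤ κ) (ht : |t| ≤ 1) : 1 - κ ≤ 1 - κ * t :=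
  sub_le_sub_left (mul_le_of_le_one_right hκ (abs_le.1 ht).2) 1

lemma abs_inner_sub_inner_le (he : ‖e‖ = 1) (hx' : ‖x'‖ = 1) :
    |inner ℝ e x - inner ℝ e' x'| ≤ ‖x - x'‖ + ‖e - e'‖ := by
  have h : (inner ℝ e x : ℝ) - inner ℝ e' x' = inner ℝ e (x - x') + inner ℝ (e - e') x' := by
    rw [inner_sub_right, inner_sub_left, sub_add_sub_cancel]
  rw [h]
  refine (abs_add_le _ _).trans (add_le_add ?_ ?_)
  · simpa [he] using abs_real_inner_le_norm e (x - x')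
  · simpa [hx'] using abs_real_inner_le_norm (e - e') x'

lemma norm_sub_inner_smul_sub_le (hx : ‖x‖ = 1) (hx' : ‖x'‖ = 1) (he : ‖e‖ = 1)
    (he' : ‖e'‖ = 1) :
    ‖(e - (inner ℝ e x : ℝ) • x) - (e' - (inner ℝ e' x' : ℝ) • x')‖ ≤
      2 * (‖x - x'‖ + ‖e - e'‖) := by
  have hnormal : ‖(inner ℝ e x : ℝ) • x - (inner ℝ e' x' : ℝ) • x'‖ ≤
      (‖x - x'‖ + ‖e - e'‖) * 1 + 1 * ‖x - x'‖ := by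
    refine (norm_smul_sub_smul_le _ _ _ _).trans ?_
    rw [hx]
    gcongr
    · exact abs_inner_sub_inner_le he hx'
    · exact abs_inner_le_one hx' he'
  rw [sub_sub_sub_comm]
  linarith [norm_sub_le (e - e') ((inner ℝ e x : ℝ) • x - (inner ℝ e' x' : ℝ) • x')]

lemma abs_mul_div_sub_mul_div_le {t t' : ℝ} (hκ0 : 0 ≤ κ) (hκ1 : κ < 1) (hr' : 0 ≤ r')
    (ht : |t| ≤ 1) (ht' : |t'| ≤ 1) :
    |κ * r / (1 - κ * t) - κ * r' / (1 - κ * t')| ≤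
      |r - r'| / (1 - κ) + r' / (1 - κ) ^ 2 * |t - t'| := by
  have hκ : 0 < 1 - κ := sub_pos.2 hκ1
  have hq := one_sub_le_one_sub_mul hκ0 ht
  have hq' := one_sub_le_one_sub_mul hκ0 ht'
  have hq0 := hκ.trans_le hq
  have hq0' := hκ.trans_le hq'
  have hsplit : κ * r / (1 - κ * t) - κ * r' / (1 - κ * t') =
      κ * (r - r') / (1 - κ * t) + κ * r' * (κ * (t - t')) / ((1 - κ * t) * (1 - κ * t')) := by
    have := hq0.ne'
    have := hq0'.ne'
    field_simp
    ring
  rw [hsplit]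
  refine (abs_add_le _ _).trans (add_le_add ?_ ?_)
  · rw [abs_div, abs_of_pos hq0, abs_mul, abs_of_nonneg hκ0]
    gcongr
    exact mul_le_of_le_one_left (abs_nonneg _) hκ1.le
  · rw [abs_div, abs_of_pos (mul_pos hq0 hq0'), abs_mul, abs_mul κ (t - t'), abs_of_nonneg hκ0,
      abs_of_nonneg (mul_nonneg hκ0 hr'), div_mul_eq_mul_div, sq]
    gcongr
    · exact mul_le_of_le_one_left hr' hκ1.le
    · exact mul_le_of_le_one_left (abs_nonneg _) hκ1.le

lemma norm_refractorGradient_sub_le {c : ℝ} (hκ0 : 0 ≤ κ) (hκ1 : κ < 1) (hr0 : 0 ≤ r')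
    (hrc : r' ≤ c) (hx : ‖x‖ = 1) (hx' : ‖x'‖ = 1) (he : ‖e‖ = 1) (he' : ‖e'‖ = 1) :
    ‖refractorGradient κ r x e - refractorGradient κ r' x' e'‖ ≤
      (2 / (1 - κ) + 4 * c / (1 - κ) ^ 2) * (|r - r'| + ‖x - x'‖ + ‖e - e'‖) := by
  have hκ : 0 < 1 - κ := sub_pos.2 hκ1
  have hc : 0 ≤ c := hr0.trans hrc
  have ht := abs_inner_le_one hx he
  have ht' := abs_inner_le_one hx' he'
  have hcoef : |κ * r / (1 - κ * inner ℝ e x) - κ * r' / (1 - κ * inner ℝ e' x')| ≤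
      |r - r'| / (1 - κ) + c / (1 - κ) ^ 2 * (‖x - x'‖ + ‖e - e'‖) := by
    refine (abs_mul_div_sub_mul_div_le hκ0 hκ1 hr0 ht ht').trans ?_
    gcongr
    exact abs_inner_sub_inner_le he hx'
  have hcoef' : |κ * r' / (1 - κ * inner ℝ e' x')| ≤ c / (1 - κ) ^ 2 := by
    have hq := one_sub_le_one_sub_mul hκ0 ht'
    rw [abs_of_nonneg (div_nonneg (by positivity) (hκ.le.trans hq))]
    gcongr
    · exact (mul_le_of_le_one_left hr0 hκ1.le).trans hrc
    · exact (pow_le_of_le_one hκ.le (sub_le_self 1 hκ0) two_ne_zero).trans hq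
  have hvec : ‖e - (inner ℝ e x : ℝ) • x‖ ≤ 2 := by
    refine (norm_sub_le _ _).trans ?_
    rw [norm_smul, he, hx, mul_one, Real.norm_eq_abs]
    linarith
  calc ‖refractorGradient κ r x e - refractorGradient κ r' x' e'‖
      ≤ (|r - r'| / (1 - κ) + c / (1 - κ) ^ 2 * (‖x - x'‖ + ‖e - e'‖)) * 2 +
          c / (1 - κ) ^ 2 * (2 * (‖x - x'‖ + ‖e - e'‖)) := by
        refine (norm_smul_sub_smul_le _ _ _ _).trans ?_
        gcongr
        exact norm_sub_inner_smul_sub_le hx hx' he he'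
    _ = 2 / (1 - κ) * |r - r'| + 4 * c / (1 - κ) ^ 2 * (‖x - x'‖ + ‖e - e'‖) := by ring
    _ ≤ (2 / (1 - κ) + 4 * c / (1 - κ) ^ 2) * |r - r'| +
          (2 / (1 - κ) + 4 * c / (1 - κ) ^ 2) * (‖x - x'‖ + ‖e - e'‖) := by
        gcongr
        · exact le_add_of_nonneg_right (by positivity)
        · exact le_add_of_nonneg_left (by positivity)
    _ = _ := by ring

end RefractorGradient

variable {n : ℕ} {κ c₁ c₂ : ℝ} {Ω S : Set (Rn n)} {E : Rn n → Set (Rn n)}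
  {s : Rn n → Rn n → ℝ} {u : Rn n → ℝ}

/-- The optical path to `Y` through the point of polar radius `r` in the direction of `X`, as a
function of `(r, X)`. -/
def polarPath (κ : ℝ) (Y : Rn n) (p : ℝ × Rn n) : ℝ := p.1 + κ * ‖Y - p.1 • dir p.2‖

lemma polarPath_eq_opticalPath {r : ℝ} {X Y : Rn n} (hr : 0 ≤ r) (hX : ‖dir X‖ = 1) :
    polarPath κ Y (r, X) = opticalPath κ (r • dir X) Y := by
  rw [polarPath, opticalPath, norm_smul, hX, mul_one, Real.norm_of_nonneg hr, norm_sub_rev]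

lemma hasFDerivAt_polarPath {r : ℝ} {x Y : Rn n} (hx : ‖x‖ = 1) (hY : Y ≠ r • x)
    (hκ : 1 - κ * inner ℝ (dir (Y - r • x)) x ≠ 0) :
    HasFDerivAt (polarPath κ Y) ((1 - κ * inner ℝ (dir (Y - r • x)) x) •
      (ContinuousLinearMap.fst ℝ ℝ (Rn n) -
        (innerSL ℝ (refractorGradient κ r x (dir (Y - r • x)))).comp
          (ContinuousLinearMap.snd ℝ ℝ (Rn n)))) (r, x) := by
  have hdx := dir_of_norm_eq_one hx
  have hdir := hasFDerivAt_dir (v := x) (norm_ne_zero_iff.1 (hx.trans_ne one_ne_zero))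
  rw [hdx, hx, inv_one, one_smul] at hdir
  have hpoint := ((hasFDerivAt_fst (𝕜 := ℝ) (p := (r, x))).smul
    (hdir.comp (r, x) hasFDerivAt_snd)).const_sub Y
  have hnorm : HasFDerivAt (fun w : Rn n => ‖w‖) (innerSL ℝ (dir (Y - r • x))) (Y - r • dir x) := by
    rw [hdx]
    exact hasFDerivAt_norm (sub_ne_zero.2 hY)
  refine ((hasFDerivAt_fst (𝕜 := ℝ) (p := (r, x))).add
    ((hnorm.comp (r, x) hpoint).const_mul κ)).congr_fderiv (ContinuousLinearMap.ext fun p => ?_)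
  simp only [Function.comp_apply, hdx, add_apply, smul_apply, sub_apply, neg_apply,
    ContinuousLinearMap.comp_apply, ContinuousLinearMap.coe_fst', ContinuousLinearMap.coe_snd',
    ContinuousLinearMap.id_apply, ContinuousLinearMap.smulRight_apply, innerSL_apply_apply,
    inner_neg_right, inner_add_right, inner_sub_right, inner_sub_left, real_inner_smul_right,
    real_inner_smul_left, smul_eq_mul, refractorGradient]
  field_simp
  ring

lemma norm_dir_sub_le_of_norm_eq_one {x X : Rn n} (hx : ‖x‖ = 1) (hX : X ≠ 0) :
    ‖dir X - x‖ ≤ 2 * ‖X - x‖ := by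
  have h := norm_dir_sub_dir_le (norm_ne_zero_iff.1 (hx.trans_ne one_ne_zero)) hX
  rwa [dir_of_norm_eq_one hx, hx, div_one, norm_sub_rev, norm_sub_rev x] at h

lemma eventually_ne_zero_and_dir_mem {U : Set (Rn n)} (hU : IsOpen U)
    (hΩU : Ω = U ∩ unitSphere n) {x : Rn n} (hx : x ∈ Ω) :
    ∀ᶠ X in 𝓝 x, X ≠ 0 ∧ dir X ∈ Ω := by
  subst hΩU
  have hx1 : ‖x‖ = 1 := mem_sphere_zero_iff_norm.1 hx.2
  have hx0 : x ≠ 0 := norm_ne_zero_iff.1 (hx1.trans_ne one_ne_zero)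
  have hdirU : ∀ᶠ X in 𝓝 x, dir X ∈ U :=
    (hasFDerivAt_dir hx0).continuousAt.eventually_mem
      (hU.mem_nhds ((dir_of_norm_eq_one hx1).symm ▸ hx.1))
  filter_upwards [hdirU, eventually_ne_nhds hx0] with X hXU hX
  exact ⟨hX, hXU, mem_sphere_zero_iff_norm.2 (norm_dir hX)⟩

lemma IsRefractor.isBigO_radialExt_sub (hκ0 : 0 < κ) (hκ1 : κ < 1) (hc₁ : 0 < c₁)
    {U : Set (Rn n)} (hU : IsOpen U) (hΩU : Ω = U ∩ unitSphere n)
    (hu : IsRefractor κ c₁ c₂ Ω S u) {x : Rn n} (hx : x ∈ Ω) :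
    (fun X => radialExt u X - radialExt u x) =O[𝓝 x] fun X => X - x := by
  have hΩ : Ω ⊆ unitSphere n := hΩU ▸ inter_subset_right
  have hx1 := norm_eq_one_of_mem hΩ hx
  have : 0 < 1 - κ := sub_pos.2 hκ1
  have hc₂ : 0 < c₂ := hc₁.trans_le ((hu.1 x hx).1.trans (hu.1 x hx).2)
  refine IsBigO.of_bound (κ * c₂ / (1 - κ) * 2) ?_
  filter_upwards [eventually_ne_zero_and_dir_mem hU hΩU hx] with X hX
  rw [radialExt, radialExt, dir_of_norm_eq_one hx1, Real.norm_eq_abs, mul_assoc]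
  refine (hu.abs_sub_le hκ0 hκ1 hc₁ hΩ hX.2 hx).trans ?_
  gcongr
  exact norm_dir_sub_le_of_norm_eq_one hx1 hX.1

lemma isLittleO_norm_mul_norm_dir_sub_rpow {x : Rn n} (hx : ‖x‖ = 1) {γ : ℝ} (hγ : 0 < γ) :
    (fun X => ‖X - x‖ * ‖dir X - x‖ ^ γ) =o[𝓝 x] fun X => X - x := by
  have hdir : ContinuousAt (dir : Rn n → Rn n) x :=
    (hasFDerivAt_dir (norm_ne_zero_iff.1 (hx.trans_ne one_ne_zero))).continuousAt
  have hlim : Tendsto (fun X => ‖dir X - x‖ ^ γ) (𝓝 x) (𝓝 0) := by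
    have h := ((hdir.sub (continuousAt_const (y := x))).norm).rpow_const (p := γ) (.inr hγ.le)
    simpa [ContinuousAt, dir_of_norm_eq_one hx, Real.zero_rpow hγ.ne'] using h
  simpa using (isBigO_refl (fun X : Rn n => ‖X - x‖) (𝓝 x)).mul_isLittleO
    ((isLittleO_one_iff ℝ).2 hlim)

lemma IsRefractor.isLittleO_polarPath_sub (hκ0 : 0 < κ) (hκ1 : κ < 1) (hc₁ : 0 < c₁)
    {U : Set (Rn n)} (hU : IsOpen U) (hΩU : Ω = U ∩ unitSphere n)
    (hA : HypA κ c₁ c₂ Ω S E s) (hB : HypB κ c₁ c₂ Ω S) (hu : IsRefractor κ c₁ c₂ Ω S u)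
    {x Y : Rn n} (hx : x ∈ Ω) (hY : Y ∈ subdiff κ Ω S u x) {C γ : ℝ} (hγ : 0 < γ)
    (hholder : ∀ x' ∈ Ω, ∀ Y' ∈ subdiff κ Ω S u x', ‖Y - Y'‖ ≤ C * ‖x - x'‖ ^ γ) :
    (fun X => polarPath κ Y (radialExt u X, X) - polarPath κ Y (radialExt u x, x)) =o[𝓝 x]
      fun X => X - x := by
  have hΩ : Ω ⊆ unitSphere n := hΩU ▸ inter_subset_right
  have hx1 := norm_eq_one_of_mem hΩ hx
  have hdx := dir_of_norm_eq_one hx1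
  have : 0 < 1 - κ := sub_pos.2 hκ1
  have hpath : ∀ X, dir X ∈ Ω →
      polarPath κ Y (radialExt u X, X) = opticalPath κ (u (dir X) • dir X) Y := fun X hX =>
    polarPath_eq_opticalPath (hc₁.le.trans (hu.1 _ hX).1) (norm_eq_one_of_mem hΩ hX)
  refine IsBigO.trans_isLittleO ?_ (isLittleO_norm_mul_norm_dir_sub_rpow hx1 hγ)
  refine IsBigO.of_bound (2 * κ ^ 2 / (1 - κ) * (2 * C)) ?_
  filter_upwards [eventually_ne_zero_and_dir_mem hU hΩU hx] with X hX
  obtain ⟨Y', hY'⟩ := hu.2 _ hX.2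
  rw [hpath X hX.2, hpath x (hdx.symm ▸ hx), hdx]
  have hlower := ((mem_subdiff_iff hκ0 hκ1 hc₁ hΩ hu.1).1 hY).2 _ hX.2
  have hupper := hu.opticalPath_le_add hκ0 hκ1 hc₁ hΩ hA hB hX.2 hx hY' hY.1
  have hYY' := hholder _ hX.2 Y' hY'
  rw [norm_sub_rev, norm_sub_rev x] at hYY'
  rw [Real.norm_of_nonneg (sub_nonneg.2 hlower), Real.norm_of_nonneg (by positivity)]
  calc _ ≤ 2 * κ ^ 2 / (1 - κ) * (‖dir X - x‖ * ‖Y' - Y‖) := by linarith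
    _ ≤ 2 * κ ^ 2 / (1 - κ) * ((2 * ‖X - x‖) * (C * ‖dir X - x‖ ^ γ)) := by
        gcongr
        exact norm_dir_sub_le_of_norm_eq_one hx1 hX.1
    _ = _ := by ring

lemma IsRefractor.hasFDerivAt_radialExt (hκ0 : 0 < κ) (hκ1 : κ < 1) (hc₁ : 0 < c₁)
    {U : Set (Rn n)} (hU : IsOpen U) (hΩU : Ω = U ∩ unitSphere n)
    (hA : HypA κ c₁ c₂ Ω S E s) (hB : HypB κ c₁ c₂ Ω S) (hu : IsRefractor κ c₁ c₂ Ω S u)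
    {x Y : Rn n} (hx : x ∈ Ω) (hY : Y ∈ subdiff κ Ω S u x) {C γ : ℝ} (hγ : 0 < γ)
    (hholder : ∀ x' ∈ Ω, ∀ Y' ∈ subdiff κ Ω S u x', ‖Y - Y'‖ ≤ C * ‖x - x'‖ ^ γ) :
    HasFDerivAt (radialExt u) (innerSL ℝ (refractorGradient κ (u x) x (dir (Y - u x • x)))) x := by
  have hΩ : Ω ⊆ unitSphere n := hΩU ▸ inter_subset_right
  have hx1 := norm_eq_one_of_mem hΩ hx
  have hX := hu.smul_mem_Gam hx
  have hden : 1 - κ * inner ℝ (dir (Y - u x • x)) x ≠ 0 :=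
    ((sub_pos.2 hκ1).trans_le (one_sub_le_one_sub_mul hκ0.le
      (abs_inner_le_one hx1 (hA.norm_dir_sub hX hY.1)))).ne'
  refine hasFDerivAt_of_isLittleO_comp hden ?_ (hu.isBigO_radialExt_sub hκ0 hκ1 hc₁ hU hΩU hx)
    (hu.isLittleO_polarPath_sub hκ0 hκ1 hc₁ hU hΩU hA hB hx hY hγ hholder)
  rw [radialExt, dir_of_norm_eq_one hx1]
  exact hasFDerivAt_polarPath hx1 (hA.ne hX hY.1) hden

lemma IsRefractor.norm_dir_sub_dir_le (hκ0 : 0 < κ) (hκ1 : κ < 1) (hc₁ : 0 < c₁)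
    (hΩ : Ω ⊆ unitSphere n) (hA : HypA κ c₁ c₂ Ω S E s) (hB : HypB κ c₁ c₂ Ω S)
    (hu : IsRefractor κ c₁ c₂ Ω S u) {x x' Y Y' : Rn n} (hx : x ∈ Ω) (hx' : x' ∈ Ω)
    (hY : Y ∈ S) (hY' : Y' ∈ S) :
    ‖dir (Y - u x • x) - dir (Y' - u x' • x')‖ ≤
      κ / c₂ * (‖Y - Y'‖ + (κ * c₂ / (1 - κ) + c₂) * ‖x - x'‖) := by
  have hX := hu.smul_mem_Gam hx
  have hc₂ : 0 < c₂ := hc₁.trans_le ((hu.1 x hx).1.trans (hu.1 x hx).2)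
  calc _ ≤ 2 / ‖Y - u x • x‖ * ‖(Y - u x • x) - (Y' - u x' • x')‖ :=
        NearField.norm_dir_sub_dir_le (sub_ne_zero.2 (hA.ne hX hY))
          (sub_ne_zero.2 (hA.ne (hu.smul_mem_Gam hx') hY'))
    _ ≤ 2 / (2 * (c₂ / κ)) * (‖Y - Y'‖ + (κ * c₂ / (1 - κ) + c₂) * ‖x - x'‖) := by
        gcongr
        · exact hB.two_mul_div_le_norm_sub hκ0 hc₁ hΩ hA hX hY
        · rw [sub_sub_sub_comm]
          exact (norm_sub_le _ _).trans
            (add_le_add_right (hu.norm_smul_sub_smul_le hκ0 hκ1 hc₁ hΩ hx hx') _)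
    _ = _ := by field_simp

lemma IsRefractor.norm_refractorGradient_sub_le (hκ0 : 0 < κ) (hκ1 : κ < 1) (hc₁ : 0 < c₁)
    (hΩ : Ω ⊆ unitSphere n) (hA : HypA κ c₁ c₂ Ω S E s) (hB : HypB κ c₁ c₂ Ω S)
    (hu : IsRefractor κ c₁ c₂ Ω S u) {x y Y Z : Rn n} (hx : x ∈ Ω) (hy : y ∈ Ω) (hY : Y ∈ S)
    (hZ : Z ∈ S) {C γ : ℝ} (hγ0 : 0 ≤ γ) (hγ1 : γ ≤ 1) (hYZ : ‖Y - Z‖ ≤ C * ‖x - y‖ ^ γ) :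
    ‖refractorGradient κ (u x) x (dir (Y - u x • x)) -
        refractorGradient κ (u y) y (dir (Z - u y • y))‖ ≤
      (2 / (1 - κ) + 4 * c₂ / (1 - κ) ^ 2) *
        ((κ * c₂ / (1 - κ) + 1 + κ / c₂ * (κ * c₂ / (1 - κ) + c₂)) * 2 + κ / c₂ * C) *
          ‖x - y‖ ^ γ := by
  have hx1 := norm_eq_one_of_mem hΩ hx
  have hy1 := norm_eq_one_of_mem hΩ hy
  have : 0 < 1 - κ := sub_pos.2 hκ1
  have : 0 < c₂ := hc₁.trans_le ((hu.1 x hx).1.trans (hu.1 x hx).2)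
  have hδ2 : ‖x - y‖ ≤ 2 := by
    refine (norm_sub_le _ _).trans_eq ?_
    rw [hx1, hy1, one_add_one_eq_two]
  have hδγ := le_two_mul_rpow (norm_nonneg _) hδ2 hγ0 hγ1
  have hdir := hu.norm_dir_sub_dir_le hκ0 hκ1 hc₁ hΩ hA hB hx hy hY hZ
  set A := 2 / (1 - κ) + 4 * c₂ / (1 - κ) ^ 2
  set Λ := κ * c₂ / (1 - κ)
  calc _ ≤ A * (|u x - u y| + ‖x - y‖ + ‖dir (Y - u x • x) - dir (Z - u y • y)‖) :=
        NearField.norm_refractorGradient_sub_le hκ0.le hκ1 (hc₁.le.trans (hu.1 y hy).1)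
          (hu.1 y hy).2 hx1 hy1 (hA.norm_dir_sub (hu.smul_mem_Gam hx) hY)
          (hA.norm_dir_sub (hu.smul_mem_Gam hy) hZ)
    _ ≤ A * (Λ * ‖x - y‖ + ‖x - y‖ + κ / c₂ * (C * ‖x - y‖ ^ γ + (Λ + c₂) * ‖x - y‖)) := by
        gcongr
        · exact hu.abs_sub_le hκ0 hκ1 hc₁ hΩ hx hy
        · exact hdir.trans (by gcongr)
    _ = A * ((Λ + 1 + κ / c₂ * (Λ + c₂)) * ‖x - y‖ + κ / c₂ * C * ‖x - y‖ ^ γ) := by ring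
    _ ≤ A * ((Λ + 1 + κ / c₂ * (Λ + c₂)) * (2 * ‖x - y‖ ^ γ) + κ / c₂ * C * ‖x - y‖ ^ γ) := by
        gcongr
    _ = _ := by ring

theorem IsRefractor.c1HolderLoc_of_holder (hκ0 : 0 < κ) (hκ1 : κ < 1) (hc₁ : 0 < c₁)
    {U : Set (Rn n)} (hU : IsOpen U) (hΩU : Ω = U ∩ unitSphere n)
    (hA : HypA κ c₁ c₂ Ω S E s) (hB : HypB κ c₁ c₂ Ω S) (hu : IsRefractor κ c₁ c₂ Ω S u)
    {γ : ℝ} (hγ0 : 0 < γ) (hγ1 : γ ≤ 1)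
    (hholder : ∀ K ⊆ Ω, IsCompact K → ∃ C : ℝ, ∀ x ∈ K, ∀ x' ∈ Ω, ∀ Y ∈ subdiff κ Ω S u x,
      ∀ Y' ∈ subdiff κ Ω S u x', ‖Y - Y'‖ ≤ C * ‖x - x'‖ ^ γ) :
    C1HolderLoc γ Ω u := by
  have hΩ : Ω ⊆ unitSphere n := hΩU ▸ inter_subset_right
  have hderiv : ∀ x ∈ Ω, ∀ Y ∈ subdiff κ Ω S u x, HasFDerivAt (radialExt u)
      (innerSL ℝ (refractorGradient κ (u x) x (dir (Y - u x • x)))) x := fun x hx Y hY => by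
    obtain ⟨C, hC⟩ := hholder {x} (singleton_subset_iff.2 hx) isCompact_singleton
    exact hu.hasFDerivAt_radialExt hκ0 hκ1 hc₁ hU hΩU hA hB hx hY hγ0
      fun x' hx' => hC x rfl x' hx' Y hY
  refine ⟨fun x hx => ?_, fun K hKΩ hK => ?_⟩
  · obtain ⟨Y, hY⟩ := hu.2 x hx
    exact (hderiv x hx Y hY).differentiableAt
  obtain ⟨C, hC⟩ := hholder K hKΩ hK
  refine ⟨(2 / (1 - κ) + 4 * c₂ / (1 - κ) ^ 2) *
    ((κ * c₂ / (1 - κ) + 1 + κ / c₂ * (κ * c₂ / (1 - κ) + c₂)) * 2 + κ / c₂ * C),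
    fun x hxK y hyK => ?_⟩
  obtain ⟨Y, hY⟩ := hu.2 x (hKΩ hxK)
  obtain ⟨Z, hZ⟩ := hu.2 y (hKΩ hyK)
  rw [(hderiv x (hKΩ hxK) Y hY).fderiv, (hderiv y (hKΩ hyK) Z hZ).fderiv, ← map_sub,
    innerSL_apply_norm]
  exact hu.norm_refractorGradient_sub_le hκ0 hκ1 hc₁ hΩ hA hB (hKΩ hxK) (hKΩ hyK) hY.1 hZ.1
    hγ0.le hγ1 (hC x hxK y (hKΩ hyK) Y hY Z hZ)

end

end NearField

end

theorem theorem5p6_general (n : ℕ) (hn : 2 ≤ n) (κ c₁ c₂ : ℝ) (hκ0 : 0 < κ) (hκ1 : κ < 1)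
    (hc₁ : 0 < c₁) (hc₂ : 0 < c₂)
    (Ω S : Set (NearField.Rn n))
    (hΩ : ∃ U : Set (NearField.Rn n), IsOpen U ∧ Ω = U ∩ NearField.unitSphere n)
    (hΩconn : IsPreconnected Ω)
    (hS : MeasurableSet S)
    (E : NearField.Rn n → Set (NearField.Rn n))
    (s : NearField.Rn n → NearField.Rn n → ℝ)
    (hA : NearField.HypA κ c₁ c₂ Ω S E s)
    (hB : NearField.HypB κ c₁ c₂ Ω S)
    (hC : NearField.HypC κ c₁ c₂ Ω E s)
    (hD : NearField.HypD κ c₁ c₂ Ω S s)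
    (f : NearField.Rn n → ℝ)
    (hf_bdd : MemLp f ∞ ((NearField.hausdorff n).restrict Ω))
    (ν : Measure (NearField.Rn n))
    (hν_ac : ν ≪ NearField.hausdorff n)
    (g : NearField.Rn n → ℝ) (hg_meas : AEMeasurable g ν) (α : ℝ)
    (hg_bdd : ∀ᵐ y ∂((NearField.hausdorff n).restrict S), g y ≤ α)
    (hg : (NearField.hausdorff n).restrict S = ν.withDensity (fun y => ENNReal.ofReal (g y)))
    (u : NearField.Rn n → ℝ)
    (hu : NearField.IsWeakSolution κ c₁ c₂ Ω S f ν u) :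
    NearField.MeasureCondition κ Ω S u ∧
      NearField.C1HolderLoc (1 / (4 * (n : ℝ) - 5)) Ω u := by
  obtain ⟨U, hU, hΩU⟩ := hΩ
  have hΩ_sphere : Ω ⊆ NearField.unitSphere n := hΩU ▸ inter_subset_right
  have hmeasure := hu.measureCondition (by lia) hκ0 hκ1 hc₁ hΩ_sphere hΩconn hS hA hB hf_bdd hν_ac
    hg_meas hg_bdd hg
  have hn' : (2 : ℝ) ≤ n := by exact_mod_cast hn
  refine ⟨hmeasure, hu.1.c1HolderLoc_of_holder hκ0 hκ1 hc₁ hU hΩU hA hB ?_ ?_ fun K hKΩ hK => ?_⟩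
  · exact one_div_pos.2 (by linarith)
  · exact (div_le_one (by linarith)).2 (by linarith)
  · exact hu.1.exists_norm_sub_le_mul_rpow hn hκ0 hκ1 hc₁ hc₂ hU hΩU hA hB hC hD hmeasure hK hKΩ

theorem theorem5p6 (n : ℕ) (hn : 2 ≤ n) (κ c₁ c₂ : ℝ) (hκ0 : 0 < κ) (hκ1 : κ < 1)
    (hc₁ : 0 < c₁) (hc₂ : c₁ < c₂)
    (Ω S : Set (NearField.Rn n))
    (hΩ : ∃ U : Set (NearField.Rn n), IsOpen U ∧ Ω = U ∩ NearField.unitSphere n)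
    (hΩconn : IsPreconnected Ω)
    (hS : MeasurableSet S)
    (E : NearField.Rn n → Set (NearField.Rn n))
    (s : NearField.Rn n → NearField.Rn n → ℝ)
    (hA : NearField.HypA κ c₁ c₂ Ω S E s)
    (hB : NearField.HypB κ c₁ c₂ Ω S)
    (hC : NearField.HypC κ c₁ c₂ Ω E s)
    (hD : NearField.HypD κ c₁ c₂ Ω S s)
    (hdiff : NearField.DifferentiableSurface S)
    (f : NearField.Rn n → ℝ)
    (hf_pos : ∀ᵐ x ∂((NearField.hausdorff n).restrict Ω), 0 < f x)
    (hf_bdd : MemLp f ∞ ((NearField.hausdorff n).restrict Ω))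
    (ν : Measure (NearField.Rn n))
    (hν_supp : ν Sᶜ = 0)
    (hν_ac : ν ≪ NearField.hausdorff n)
    (g : NearField.Rn n → ℝ) (hg_meas : Measurable g) (α : ℝ)
    (hg_bdd : ∀ᵐ y ∂((NearField.hausdorff n).restrict S), 0 ≤ g y ∧ g y ≤ α)
    (hg : (NearField.hausdorff n).restrict S = ν.withDensity (fun y => ENNReal.ofReal (g y)))
    (u : NearField.Rn n → ℝ)
    (hu : NearField.IsWeakSolution κ c₁ c₂ Ω S f ν u) :
    NearField.MeasureCondition κ Ω S u ∧
      NearField.C1HolderLoc (1 / (4 * (n : ℝ) - 5)) Ω u := by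
  exact theorem5p6_general n hn κ c₁ c₂ hκ0 hκ1 hc₁ (hc₁.trans hc₂) Ω S hΩ hΩconn hS E s hA hB hC hD
    f hf_bdd ν hν_ac g hg_meas.aemeasurable α (hg_bdd.mono fun _ h => h.2) hg u hu
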